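/- For a partition $\lambda$, let $d(\lambda)$ denote its Durfee rank, i.e. the side length of the largest square contained in its Young diagram, and let $s_\lambda$ denote the Schur function. For homogeneous symmetric functions $f,g$ of degree $n$ (over $\mathbb{Q}$), write $f\geq g$ if $f-g$ is Schur-positive, i.e. a linear combination of the $s_\lambda$, $\lambda\vdash n$, with nonnegative coefficients. (Empty sums are $0$.) Let $m\geq 2$ and $n\geq 0$ be integers, and let $k\ge 0$ be an integer. 1. If $\lfloor \frac{n-1}{2}\rfloor\leq k\leq \lfloor \frac{n-1}{2}\rfloor+m^2$, then $$\Big(\sum_{\substack{\alpha\vdash k\\ d(\alpha)=m}}s_{\alpha}\Big)\Big(\sum_{\substack{\beta \vdash n-k\\ d(\beta)=m}} s_{\beta}\Big)\geq \sum_{\substack{\lambda\vdash n \\ d(\lambda)=2m}} s_{\lambda}.$$ 2. If $\lfloor \frac{n-1}{2}\rfloor\leq k\leq \lfloor \frac{n-1}{2}\rfloor+m^2-(m-1)$ and $n-k\geq m^2$ (so that partitions $\beta\vdash n-k$ with $d(\beta)=m$ exist), then $$\Big(\sum_{\substack{\alpha\vdash k\\ m-1\leq d(\alpha)\leq m}}s_{\alpha}\Big)\Big(\sum_{\substack{\beta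 \vdash n-k\\ d(\beta)=m}} s_{\beta}\Big)\geq \sum_{\substack{\lambda\vdash n \\ d(\lambda)=2m-1}} s_{\lambda}.$$ -/

import Mathlib

open scoped BigOperators

noncomputable section

namespace DurfeeSchur

/-- The Young diagram of an integer partition: row `i` (counted from `0`) has as many cells as the
`i`-th largest part. -/
def diagram {n : ℕ} (p : n.Partition) : YoungDiagram :=
  YoungDiagram.ofRowLens (p.parts.sort (· ≥ ·)) (Multiset.pairwise_sort p.parts (· ≥ ·)).sortedGE

/-- The Durfee rank of a Young diagram: the largest `r` such that the `r × r` square in the upper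
left corner is contained in the diagram. -/
def durfeeRank (μ : YoungDiagram) : ℕ :=
  sSup {r : ℕ | Finset.range r ×ˢ Finset.range r ⊆ μ.cells}

/-- The maximum in the definition of the Durfee rank is attained. -/
theorem isGreatest_durfeeRank (μ : YoungDiagram) :
    IsGreatest {r : ℕ | Finset.range r ×ˢ Finset.range r ⊆ μ.cells} (durfeeRank μ) := by
  have hne : {r : ℕ | Finset.range r ×ˢ Finset.range r ⊆ μ.cells}.Nonempty := ⟨0, by simp⟩
  have hbd : BddAbove {r : ℕ | Finset.range r ×ˢ Finset.range r ⊆ μ.cells} := by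
    refine ⟨μ.cells.card, fun r hr => ?_⟩
    have h := Finset.card_le_card (show Finset.range r ×ˢ Finset.range r ⊆ μ.cells from hr)
    simp only [Finset.card_product, Finset.card_range] at h
    exact (Nat.le_mul_self r).trans h
  exact ⟨Nat.sSup_mem hne hbd, fun r hr => le_csSup hbd hr⟩

/-- The semistandard Young tableaux of shape `μ` and content `d`: for each `i`, exactly `d i` cells
carry the entry `i`. -/
def tableauxOfContent (μ : YoungDiagram) (d : ℕ →₀ ℕ) : Set (SemistandardYoungTableau μ) :=
  {T | ∀ i : ℕ, (μ.cells.filter fun c => T c.1 c.2 = i).card = d i}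

/-- There are finitely many tableaux of given shape and content. -/
theorem finite_tableauxOfContent (μ : YoungDiagram) (d : ℕ →₀ ℕ) :
    (tableauxOfContent μ d).Finite := by
  let F : tableauxOfContent μ d → (μ.cells → d.support) := fun T c =>
    ⟨T.1 c.1.1 c.1.2, by
      rw [Finsupp.mem_support_iff, ← T.2]
      exact (Finset.card_pos.2 ⟨c.1, by simp⟩).ne'⟩
  have hF : Function.Injective F := by
    intro T T' h
    apply Subtype.ext
    ext i j
    by_cases hc : (i, j) ∈ μ
    · have := congrFun h ⟨(i, j), (YoungDiagram.mem_cells _).2 hc⟩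
      exact congrArg Subtype.val this
    · rw [T.1.zeros hc, T'.1.zeros hc]
  have : Finite (tableauxOfContent μ d) := Finite.of_injective F hF
  exact Set.toFinite _

/-- The Schur function `s_μ`, in the countably many variables `x_0, x_1, …`, as a formal power
series over `ℚ`: the coefficient of `x^d` is the number of semistandard Young tableaux of shape `μ`
and content `d`. -/
def schur (μ : YoungDiagram) : MvPowerSeries ℕ ℚ :=
  fun d => ((tableauxOfContent μ d).ncard : ℚ)

/-- `f` is a Schur-positive symmetric function of degree `n`: a linear combination with nonnegative
coefficients of the Schur functions `s_λ`, `λ ⊢ n`. -/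
def SchurPositive (n : ℕ) (f : MvPowerSeries ℕ ℚ) : Prop :=
  ∃ c : n.Partition → ℚ, (∀ p, 0 ≤ c p) ∧ f = ∑ p, c p • schur (diagram p)

/-- `f ≥ g` in degree `n`: the difference `f - g` is Schur-positive. -/
def SchurGE (n : ℕ) (f g : MvPowerSeries ℕ ℚ) : Prop :=
  SchurPositive n (f - g)

end DurfeeSchur

end

/-!
Since a product of Schur functions is a nonnegative combination of Schur functions, both
inequalities say that every partition `λ` of `n` of the given Durfee rank occurs in the product
`s_α s_β` for some `α ⊢ k`, `β ⊢ n - k` of the prescribed Durfee ranks.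

*Positivity.*  Tableaux are encoded as Gelfand–Tsetlin patterns, on which the Bender–Knuth involutions
are piecewise linear reflections (`toggle`).  Following Stembridge, an alternant times a Schur
polynomial is a sum of alternants over all patterns; a pattern that is not dominant is cancelled by
its toggle in the columns to the left of the defect (`sum_alt_not_dominant`).  The case `μ = 0` is the
bialternant formula, and dividing by the Vandermonde determinant gives the Littlewood–Richardson rule
(`schurPoly_mul_schurPoly`), which is carried over to infinitely many variables in `schur_mul_schur`.

*Occurrence.*  Read row by row, the Littlewood–Richardson condition is linear (`IsWitness`), so that
`s_λ` occurring in `s_α s_β` and `s_λ'` in `s_α' s_β'` implies that `s_(λ + λ')` occurs in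
`s_(α + α') s_(β + β')`.  Adding two-column instances of the Pieri rule (`isWitness_col`), one may
replace two columns of lengths `c ≥ d` of `λ` by a column of `α` and a column of `β` of lengths
between `d` and `c` with the same total, or cut a single column into two.

*Durfee ranks.*  A partition has Durfee rank `p` exactly if at least `p` of its columns have length
at least `p` and at most `p` of them are longer than `p`.  For `d(λ) = 2m`, the first `2m` columns are
paired; each pair gives one long column to `α` and one to `β`, and the columns to the right are cut
into pieces of length at most `m`.  The possible sizes of `α` fill an interval
containing all the required `k` (`splits_even`).  For `d(λ) = 2m - 1` one column of the Durfee square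
remains without a partner.  If no row below the square and no column to its right has length at
least `m`, that column provides a long column of `β` only, and `d(α) = m - 1`; otherwise it provides,
together with the longest such row or column, long columns for both (`splits_odd`).
-/

namespace DurfeeSchur

/-! ### Gelfand–Tsetlin patterns and their Bender–Knuth toggles -/

/-- A Gelfand–Tsetlin pattern of shape `β` with `N` letters.  It encodes a semistandard tableau with
entries smaller than `N`: `g k i` is the number of cells in row `i` whose entry is smaller than `k`.
All levels `k ≥ N` repeat the shape. -/
structure IsPattern (N : ℕ) (β : ℕ → ℕ) (g : ℕ → ℕ → ℕ) : Prop where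
  zero : ∀ i, g 0 i = 0
  mono : ∀ k i, g k i ≤ g (k + 1) i
  inter : ∀ k i, g (k + 1) (i + 1) ≤ g k i
  top : ∀ k, N ≤ k → ∀ i, g k i = β i

namespace IsPattern

variable {N : ℕ} {β : ℕ → ℕ} {g : ℕ → ℕ → ℕ}

theorem mono_le (h : IsPattern N β g) {k l : ℕ} (hkl : k ≤ l) (i : ℕ) : g k i ≤ g l i :=
  monotone_nat_of_le_succ (f := fun k => g k i) (fun k => h.mono k i) hkl

theorem le_shape (h : IsPattern N β g) (k i : ℕ) : g k i ≤ β i := by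
  rw [← h.top (max k N) (le_max_right _ _) i]
  exact h.mono_le (le_max_left _ _) i

theorem anti_succ (h : IsPattern N β g) (k i : ℕ) : g k (i + 1) ≤ g k i :=
  (h.mono k (i + 1)).trans (h.inter k i)

theorem anti (h : IsPattern N β g) (k : ℕ) {i j : ℕ} (hij : i ≤ j) : g k j ≤ g k i :=
  antitone_nat_of_succ_le (f := fun i => g k i) (fun i => h.anti_succ k i) hij

theorem eq_zero (h : IsPattern N β g) {k i : ℕ} (hki : k ≤ i) : g k i = 0 := by
  induction k generalizing i with
  | zero => exact h.zero i
  | succ k ih =>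
    obtain ⟨i, rfl⟩ : ∃ j, i = j + 1 := ⟨i - 1, by omega⟩
    have := h.inter k i
    have := ih (i := i) (by omega)
    omega

theorem shape_eq_zero (h : IsPattern N β g) {i : ℕ} (hi : N ≤ i) : β i = 0 := by
  rw [← h.top N le_rfl i]
  exact h.eq_zero hi

end IsPattern

theorem finite_isPattern (N : ℕ) (β : ℕ → ℕ) : {g | IsPattern N β g}.Finite := by
  let F : {g | IsPattern N β g} → (Fin N → (i : Fin N) → Fin (β i + 1)) := fun g k i =>
    ⟨g.1 k i, Nat.lt_succ_of_le (IsPattern.le_shape g.2 k i)⟩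
  have hF : Function.Injective F := by
    rintro ⟨g, hg⟩ ⟨g', hg'⟩ h
    refine Subtype.ext (funext fun k => funext fun i => ?_)
    change IsPattern N β g at hg
    change IsPattern N β g' at hg'
    change g k i = g' k i
    rcases le_or_gt N k with hk | hk
    · rw [hg.top k hk, hg'.top k hk]
    · rcases le_or_gt N i with hi | hi
      · rw [hg.eq_zero (hk.le.trans hi), hg'.eq_zero (hk.le.trans hi)]
      · have := congrFun (congrFun h ⟨k, hk⟩) ⟨i, hi⟩
        simpa [F] using this
  have : Finite {g | IsPattern N β g} := Finite.of_injective F hF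
  exact Set.toFinite _

/-- The finite set of patterns of shape `β` with `N` letters. -/
noncomputable def patterns (N : ℕ) (β : ℕ → ℕ) : Finset (ℕ → ℕ → ℕ) :=
  (finite_isPattern N β).toFinset

@[simp] theorem mem_patterns {N : ℕ} {β : ℕ → ℕ} {g : ℕ → ℕ → ℕ} :
    g ∈ patterns N β ↔ IsPattern N β g := by
  simp [patterns]

/-- The number of cells, in the columns with index at least `j`, of level `k` of a pattern. -/
def excess (N : ℕ) (g : ℕ → ℕ → ℕ) (j k : ℕ) : ℕ :=
  ∑ i ∈ Finset.range N, (g k i - j)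

/-- The number of occurrences of the letter `k` in the tableau encoded by `g`. -/
def wt (N : ℕ) (g : ℕ → ℕ → ℕ) (k : ℕ) : ℕ :=
  excess N g 0 (k + 1) - excess N g 0 k

section Toggle

variable {N : ℕ} {β : ℕ → ℕ} {g : ℕ → ℕ → ℕ}

/-- The largest value allowed by levels `k` and `k + 2` in row `i` of level `k + 1`. -/
def upper (g : ℕ → ℕ → ℕ) (k : ℕ) : ℕ → ℕ
  | 0 => g (k + 2) 0
  | i + 1 => min (g (k + 2) (i + 1)) (g k i)

/-- The smallest value allowed by levels `k` and `k + 2` in row `i` of level `k + 1`. -/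
def lower (g : ℕ → ℕ → ℕ) (k i : ℕ) : ℕ :=
  max (g (k + 2) (i + 1)) (g k i)

theorem IsPattern.lower_le (h : IsPattern N β g) (k i : ℕ) : lower g k i ≤ g (k + 1) i :=
  max_le (h.inter (k + 1) i) (h.mono k i)

theorem IsPattern.le_upper (h : IsPattern N β g) (k i : ℕ) : g (k + 1) i ≤ upper g k i := by
  cases i with
  | zero => exact h.mono (k + 1) 0
  | succ i => exact le_min (h.mono (k + 1) (i + 1)) (h.inter k i)

/-- The Bender–Knuth involution exchanging the letters `k` and `k + 1`, applied to the columns with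
index smaller than `j` only.  On patterns it reflects every entry of level `k + 1` in the interval of
its possible values. -/
def toggle (j k : ℕ) (g : ℕ → ℕ → ℕ) : ℕ → ℕ → ℕ :=
  Function.update g (k + 1) fun i =>
    if j < g (k + 1) i then g (k + 1) i else min (upper g k i) j + lower g k i - g (k + 1) i

/-- Column `j` contains no letter `k`: every row of level `k + 1` with a cell in column `j` has
that cell already at level `k`. -/
def IsFree (j k : ℕ) (g : ℕ → ℕ → ℕ) : Prop :=
  ∀ i, j < g (k + 1) i → j < g k i

theorem toggle_of_ne {j k l : ℕ} (h : l ≠ k + 1) : toggle j k g l = g l :=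
  Function.update_of_ne h _ _

theorem toggle_apply (j k i : ℕ) : toggle j k g (k + 1) i =
    if j < g (k + 1) i then g (k + 1) i else min (upper g k i) j + lower g k i - g (k + 1) i := by
  simp [toggle]

theorem upper_toggle (j k : ℕ) : upper (toggle j k g) k = upper g k := by
  funext i
  cases i <;> simp [upper, toggle_of_ne]

theorem lower_toggle (j k : ℕ) : lower (toggle j k g) k = lower g k := by
  funext i
  simp [lower, toggle_of_ne]

theorem toggle_mem (h : IsPattern N β g) (j k i : ℕ) :
    lower g k i ≤ toggle j k g (k + 1) i ∧ toggle j k g (k + 1) i ≤ upper g k i := by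
  have h1 := h.lower_le k i
  have h2 := h.le_upper k i
  rw [toggle_apply]
  split_ifs with hj <;> omega

theorem lt_toggle_iff (h : IsPattern N β g) (j k i : ℕ) :
    j < toggle j k g (k + 1) i ↔ j < g (k + 1) i := by
  have h1 := h.lower_le k i
  rw [toggle_apply]
  split_ifs with hj <;> omega

theorem IsPattern.toggle (h : IsPattern N β g) (j : ℕ) {k : ℕ} (hk : k + 1 < N) :
    IsPattern N β (toggle j k g) where
  zero i := by rw [toggle_of_ne (by omega)]; exact h.zero i
  top l hl i := by rw [toggle_of_ne (by omega)]; exact h.top l hl i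
  mono l i := by
    by_cases h1 : l = k + 1
    · subst h1
      rw [toggle_of_ne (l := k + 1 + 1) (by omega)]
      refine (toggle_mem h j k i).2.trans ?_
      cases i with
      | zero => exact le_rfl
      | succ i => exact min_le_left _ _
    · by_cases h2 : l = k
      · subst h2
        rw [toggle_of_ne (l := l) (by omega)]
        exact (le_max_right _ _).trans (toggle_mem h j l i).1
      · rw [toggle_of_ne h1, toggle_of_ne (by omega)]
        exact h.mono l i
  inter l i := by
    by_cases h1 : l = k + 1
    · subst h1
      rw [toggle_of_ne (l := k + 1 + 1) (by omega)]
      exact (le_max_left _ _).trans (toggle_mem h j k i).1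
    · by_cases h2 : l = k
      · subst h2
        rw [toggle_of_ne (l := l) (by omega)]
        exact (toggle_mem h j l (i + 1)).2.trans (min_le_right _ _)
      · rw [toggle_of_ne h1, toggle_of_ne (by omega)]
        exact h.inter l i

theorem toggle_toggle (h : IsPattern N β g) (j k : ℕ) : toggle j k (toggle j k g) = g := by
  funext l i
  by_cases hl : l = k + 1
  · subst hl
    rw [toggle_apply, upper_toggle, lower_toggle]
    simp only [lt_toggle_iff h]
    have h1 := h.lower_le k i
    have h2 := h.le_upper k i
    rw [toggle_apply]
    split_ifs with hj <;> omega
  · rw [toggle_of_ne hl, toggle_of_ne hl]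

theorem excess_of_ne {j j' k l : ℕ} (hl : l ≠ k + 1) :
    excess N (toggle j k g) j' l = excess N g j' l := by
  simp [excess, toggle_of_ne hl]

theorem excess_toggle_of_le (h : IsPattern N β g) {j j' : ℕ} (k l : ℕ) (hj : j ≤ j') :
    excess N (toggle j k g) j' l = excess N g j' l := by
  by_cases hl : l = k + 1
  · subst hl
    refine Finset.sum_congr rfl fun i _ => ?_
    have h1 := h.lower_le k i
    rw [toggle_apply]
    split_ifs with h2 <;> omega
  · exact excess_of_ne hl

/-- The sum of the upper and lower bounds of a level is the sum of the two adjacent levels; this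
also holds after truncation at column `j`. -/
theorem sum_upper_add_lower (h : IsPattern N β g) (j : ℕ) {k : ℕ} (hk : k + 1 < N) :
    ∑ i ∈ Finset.range N, (min (upper g k i) j + min (lower g k i) j) =
      ∑ i ∈ Finset.range N, (min (g (k + 2) i) j + min (g k i) j) := by
  obtain ⟨M, rfl⟩ : ∃ M, N = M + 1 := ⟨N - 1, by omega⟩
  have e1 : lower g k M = 0 := by
    simp [lower, h.eq_zero (show k + 2 ≤ M + 1 by omega), h.eq_zero (show k ≤ M by omega)]
  have e2 : g k M = 0 := h.eq_zero (by omega)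
  rw [Finset.sum_add_distrib, Finset.sum_add_distrib, Finset.sum_range_succ',
    Finset.sum_range_succ (fun i => min (lower g k i) j), Finset.sum_range_succ',
    Finset.sum_range_succ (fun i => min (g k i) j), e1, e2]
  have : ∑ i ∈ Finset.range M, min (upper g k (i + 1)) j + ∑ i ∈ Finset.range M, min (lower g k i) j =
      ∑ i ∈ Finset.range M, min (g (k + 2) (i + 1)) j + ∑ i ∈ Finset.range M, min (g k i) j := by
    rw [← Finset.sum_add_distrib, ← Finset.sum_add_distrib]
    refine Finset.sum_congr rfl fun i _ => ?_
    simp only [upper, lower]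
    omega
  have e3 : upper g k 0 = g (k + 2) 0 := rfl
  rw [e3]
  omega

/-- The effect of a toggle on the row sum of the toggled level. -/
theorem excess_toggle (h : IsPattern N β g) {j k : ℕ} (hk : k + 1 < N) (hf : IsFree j k g) :
    excess N (toggle j k g) 0 (k + 1) + excess N g 0 (k + 1) + excess N g j (k + 2) + excess N g j k =
      excess N g 0 (k + 2) + excess N g 0 k + 2 * excess N g j (k + 1) := by
  have key := sum_upper_add_lower h j hk
  have h1 : excess N (toggle j k g) 0 (k + 1) + excess N g 0 (k + 1) =
      ∑ i ∈ Finset.range N, (min (upper g k i) j + min (lower g k i) j) +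
        2 * excess N g j (k + 1) := by
    unfold excess
    rw [Finset.mul_sum, ← Finset.sum_add_distrib, ← Finset.sum_add_distrib]
    refine Finset.sum_congr rfl fun i _ => ?_
    have h1 := h.lower_le k i
    have h2 := h.le_upper k i
    have h3 := hf i
    have h4 : g k i ≤ lower g k i := le_max_right _ _
    rw [toggle_apply]
    split_ifs with hj
    · have := h3 hj
      omega
    · omega
  have h2 : ∑ i ∈ Finset.range N, (min (g (k + 2) i) j + min (g k i) j) + excess N g j (k + 2) +
      excess N g j k = excess N g 0 (k + 2) + excess N g 0 k := by
    unfold excess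
    rw [← Finset.sum_add_distrib, ← Finset.sum_add_distrib, ← Finset.sum_add_distrib]
    refine Finset.sum_congr rfl fun i _ => ?_
    omega
  omega

theorem IsPattern.excess_mono (h : IsPattern N β g) (j k : ℕ) : excess N g j k ≤ excess N g j (k + 1) :=
  Finset.sum_le_sum fun i _ => Nat.sub_le_sub_right (h.mono k i) j

/-- The toggle over all columns exchanges the multiplicities of two adjacent letters. -/
theorem wt_toggle_full (h : IsPattern N β g) {j k : ℕ} (hk : k + 1 < N) (hj : ∀ i, β i ≤ j) :
    wt N (toggle j k g) k = wt N g (k + 1) ∧ wt N (toggle j k g) (k + 1) = wt N g k := by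
  have hf : IsFree j k g := fun i hi => absurd (h.le_shape (k + 1) i) (by have := hj i; omega)
  have hz : ∀ l, excess N g j l = 0 := fun l => Finset.sum_eq_zero fun i _ => by
    have := h.le_shape l i
    have := hj i
    omega
  have key := excess_toggle h hk hf
  rw [hz, hz, hz] at key
  have h1 := h.excess_mono 0 k
  have h2 := h.excess_mono 0 (k + 1)
  unfold wt
  rw [excess_of_ne (l := k + 1 + 1) (by omega), excess_of_ne (l := k) (by omega)]
  rw [show k + 1 + 1 = k + 2 from rfl] at *
  omega

theorem wt_toggle_of_ne {j k l : ℕ} (h1 : l ≠ k) (h2 : l ≠ k + 1) :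
    wt N (toggle j k g) l = wt N g l := by
  unfold wt
  rw [excess_of_ne (by omega), excess_of_ne h2]

end Toggle

/-! ### Dominant patterns and the cancellation of the others -/

section Dominant

variable {N : ℕ} {β μ : ℕ → ℕ} {g : ℕ → ℕ → ℕ}

/-- Adding to `μ` the content of the columns `≥ j` of the tableau keeps the parts `k` and `k + 1` in
decreasing order. -/
def DomAt (N : ℕ) (μ : ℕ → ℕ) (g : ℕ → ℕ → ℕ) (j k : ℕ) : Prop :=
  μ (k + 1) + excess N g j (k + 2) + excess N g j k ≤ μ k + 2 * excess N g j (k + 1)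

/-- The Littlewood–Richardson condition: for every `j`, adding to `μ` the content of the columns
`≥ j` of the tableau gives a partition. -/
def Dominant (N : ℕ) (μ : ℕ → ℕ) (g : ℕ → ℕ → ℕ) : Prop :=
  ∀ j k, k + 1 < N → DomAt N μ g j k

/-- The number of cells of column `j` in level `k`. -/
def height (N : ℕ) (g : ℕ → ℕ → ℕ) (j k : ℕ) : ℕ :=
  ∑ i ∈ Finset.range N, if j < g k i then 1 else 0

theorem excess_eq_add_height (j k : ℕ) :
    excess N g j k = excess N g (j + 1) k + height N g j k := by
  unfold excess height
  rw [← Finset.sum_add_distrib]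
  refine Finset.sum_congr rfl fun i _ => ?_
  split_ifs <;> omega

theorem height_mono (h : IsPattern N β g) (j k : ℕ) : height N g j k ≤ height N g j (k + 1) := by
  refine Finset.sum_le_sum fun i _ => ?_
  have := h.mono k i
  split_ifs <;> omega

theorem height_succ_le (h : IsPattern N β g) (j k : ℕ) :
    height N g j (k + 1) ≤ height N g j k + 1 := by
  unfold height
  cases N with
  | zero => simp
  | succ M =>
    rw [Finset.sum_range_succ', Finset.sum_range_succ]
    have : ∑ i ∈ Finset.range M, (if j < g (k + 1) (i + 1) then 1 else 0) ≤
        ∑ i ∈ Finset.range M, if j < g k i then 1 else 0 := by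
      refine Finset.sum_le_sum fun i _ => ?_
      have := h.inter k i
      split_ifs <;> omega
    split_ifs <;> omega

/-- If dominance fails at column `j` but not at column `j + 1`, it fails by exactly one, and column `j`
contains no letter `k`. -/
theorem isFree_of_not_domAt (h : IsPattern N β g) {j k : ℕ} (hk : k + 1 < N)
    (h1 : DomAt N μ g (j + 1) k) (h2 : ¬ DomAt N μ g j k) :
    IsFree j k g ∧
      μ (k + 1) + excess N g j (k + 2) + excess N g j k = μ k + 2 * excess N g j (k + 1) + 1 := by
  unfold DomAt at h1 h2
  have a1 := height_mono h j k
  have a2 := height_mono h j (k + 1)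
  have a3 := height_succ_le h j k
  have a4 := height_succ_le h j (k + 1)
  have e0 := excess_eq_add_height (N := N) (g := g) j k
  have e1 := excess_eq_add_height (N := N) (g := g) j (k + 1)
  have e2 := excess_eq_add_height (N := N) (g := g) j (k + 2)
  rw [show k + 1 + 1 = k + 2 from rfl] at *
  refine ⟨?_, by omega⟩
  have heq : height N g j k = height N g j (k + 1) := by omega
  intro i hi
  have hiN : i < N := by
    by_contra hc
    rw [h.eq_zero (by omega)] at hi
    omega
  have hall := (Finset.sum_eq_sum_iff_of_le (s := Finset.range N)
    (f := fun i => if j < g k i then 1 else 0) (g := fun i => if j < g (k + 1) i then 1 else 0)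
    (fun i _ => by have := h.mono k i; split_ifs <;> omega)).1 heq i
      (Finset.mem_range.2 hiN)
  by_contra hc
  simp [hi, hc] at hall

/-- A position where dominance fails: the last such column, and the first letter failing there. -/
def IsDefect (N : ℕ) (μ : ℕ → ℕ) (g : ℕ → ℕ → ℕ) (p : ℕ × ℕ) : Prop :=
  p.2 + 1 < N ∧ ¬ DomAt N μ g p.1 p.2 ∧ (∀ j > p.1, ∀ k, k + 1 < N → DomAt N μ g j k) ∧
    ∀ k < p.2, DomAt N μ g p.1 k

theorem IsDefect.unique {p q : ℕ × ℕ} (hp : IsDefect N μ g p) (hq : IsDefect N μ g q) : p = q := by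
  obtain ⟨a1, a2, a3, a4⟩ := hp
  obtain ⟨b1, b2, b3, b4⟩ := hq
  have h1 : p.1 = q.1 := by
    rcases lt_trichotomy p.1 q.1 with h | h | h
    · exact absurd (a3 _ h _ b1) b2
    · exact h
    · exact absurd (b3 _ h _ a1) a2
  refine Prod.ext h1 ?_
  rcases lt_trichotomy p.2 q.2 with h | h | h
  · exact absurd (h1 ▸ b4 _ h) a2
  · exact h
  · exact absurd (h1 ▸ a4 _ h) b2

theorem exists_isDefect (h : IsPattern N β g) (hμ : Antitone μ) (hd : ¬ Dominant N μ g) :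
    ∃ p, IsDefect N μ g p := by
  classical
  have hbig : ∀ j, β 0 ≤ j → ∀ k, DomAt N μ g j k := by
    intro j hj k
    have hz : ∀ l, excess N g j l = 0 := fun l => Finset.sum_eq_zero fun i _ => by
      have := h.le_shape l 0
      have := h.anti l (Nat.zero_le i)
      omega
    unfold DomAt
    rw [hz, hz, hz]
    simpa using hμ (Nat.le_succ k)
  let S := (Finset.range (β 0)).filter fun j => ∃ k, k + 1 < N ∧ ¬ DomAt N μ g j k
  have hS : S.Nonempty := by
    unfold Dominant at hd
    push Not at hd
    obtain ⟨j, k, hk, hjk⟩ := hd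
    refine ⟨j, Finset.mem_filter.2 ⟨?_, k, hk, hjk⟩⟩
    rw [Finset.mem_range]
    by_contra hc
    exact hjk (hbig j (not_lt.1 hc) k)
  have hex := (Finset.mem_filter.1 (S.max'_mem hS)).2
  refine ⟨(S.max' hS, Nat.find hex), (Nat.find_spec hex).1, (Nat.find_spec hex).2, ?_, ?_⟩
  · intro j hj k hk
    by_contra hc
    have hjS : j ∈ S := by
      refine Finset.mem_filter.2 ⟨?_, k, hk, hc⟩
      rw [Finset.mem_range]
      by_contra hc'
      exact hc (hbig j (not_lt.1 hc') k)
    exact absurd (S.le_max' j hjS) (not_le.2 hj)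
  · intro k hk
    have := Nat.find_min hex hk
    have h1 := (Nat.find_spec hex).1
    dsimp only at hk ⊢
    by_contra hc
    exact this ⟨by omega, hc⟩

theorem IsDefect.toggle (h : IsPattern N β g) {p : ℕ × ℕ} (hp : IsDefect N μ g p) :
    IsDefect N μ (toggle p.1 p.2 g) p := by
  have key : ∀ j, p.1 ≤ j → ∀ k, DomAt N μ (DurfeeSchur.toggle p.1 p.2 g) j k ↔ DomAt N μ g j k := by
    intro j hj k
    unfold DomAt
    simp only [excess_toggle_of_le h _ _ hj]
  obtain ⟨a1, a2, a3, a4⟩ := hp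
  refine ⟨a1, by rwa [key _ le_rfl], fun j hj k hk => (key _ (le_of_lt hj) k).2 (a3 j hj k hk),
    fun k hk => (key _ le_rfl k).2 (a4 k hk)⟩

/-- The staircase `(N - 1, …, 1, 0)`, which turns partitions into strict ones. -/
def stair (N i : ℕ) : ℕ := N - 1 - i

/-- Toggling at the defect exchanges two adjacent entries of `μ + δ + wt`. -/
theorem IsDefect.add_wt_toggle (h : IsPattern N β g) {p : ℕ × ℕ} (hp : IsDefect N μ g p) :
    (μ p.2 + stair N p.2 + wt N (DurfeeSchur.toggle p.1 p.2 g) p.2 =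
      μ (p.2 + 1) + stair N (p.2 + 1) + wt N g (p.2 + 1)) ∧
    (μ (p.2 + 1) + stair N (p.2 + 1) + wt N (DurfeeSchur.toggle p.1 p.2 g) (p.2 + 1) =
      μ p.2 + stair N p.2 + wt N g p.2) := by
  obtain ⟨j, k⟩ := p
  have hk : k + 1 < N := hp.1
  obtain ⟨hf, he⟩ := isFree_of_not_domAt h hk (hp.2.2.1 _ (Nat.lt_succ_self _) _ hk) hp.2.1
  have key := excess_toggle h hk hf
  have h1 := h.excess_mono 0 k
  have h2 := h.excess_mono 0 (k + 1)
  have h3 := (h.toggle j hk).excess_mono 0 k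
  have h4 := (h.toggle j hk).excess_mono 0 (k + 1)
  dsimp only at *
  rw [show k + 1 + 1 = k + 2 from rfl] at *
  unfold wt stair
  rw [show k + 1 + 1 = k + 2 from rfl] at *
  rw [excess_of_ne (l := k + 2) (by omega), excess_of_ne (l := k) (by omega)] at *
  constructor <;> omega

end Dominant

/-! ### The pattern of highest weight -/

section HighestWeight

variable {N : ℕ} {β : ℕ → ℕ} {g : ℕ → ℕ → ℕ}

/-- The pattern of the tableau whose row `i` is filled with the letter `i`. -/
def highest (β : ℕ → ℕ) (k i : ℕ) : ℕ := if i < k then β i else 0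

theorem isPattern_highest (hβ : Antitone β) (hN : ∀ i, N ≤ i → β i = 0) :
    IsPattern N β (highest β) where
  zero i := by simp [highest]
  mono k i := by unfold highest; split_ifs <;> omega
  inter k i := by
    have := hβ (Nat.le_succ i)
    rw [Nat.succ_eq_add_one] at this
    unfold highest; split_ifs <;> omega
  top k hk i := by
    unfold highest
    split_ifs with h
    · rfl
    · exact (hN i (by omega)).symm

theorem excess_highest {j k : ℕ} (hk : k ≤ N) :
    excess N (highest β) j k = ∑ i ∈ Finset.range k, (β i - j) := by
  unfold excess highest
  rw [← Finset.sum_subset (Finset.range_mono hk)]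
  · refine Finset.sum_congr rfl fun i hi => ?_
    rw [if_pos (Finset.mem_range.1 hi)]
  · intro i _ hi
    rw [if_neg (by simpa using hi), Nat.zero_sub]

theorem wt_highest {k : ℕ} (hk : k < N) : wt N (highest β) k = β k := by
  unfold wt
  rw [excess_highest hk, excess_highest hk.le, Finset.sum_range_succ]
  simp

theorem dominant_highest (hβ : Antitone β) : Dominant N (fun _ => 0) (highest β) := by
  intro j k hk
  unfold DomAt
  rw [excess_highest (by omega), excess_highest (by omega), excess_highest (by omega),
    Finset.sum_range_succ _ (k + 1), Finset.sum_range_succ]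
  have := hβ (Nat.le_succ k)
  rw [Nat.succ_eq_add_one] at this
  beta_reduce
  omega

/-- For `μ = 0` the dominant pattern is unique: if row `i` is the first one to contain a letter other
than `i`, then in the column of its last cell the condition fails. -/
theorem Dominant.eq_highest (h : IsPattern N β g) (hd : Dominant N (fun _ => 0) g) :
    g = highest β := by
  have key : ∀ i k, i < k → g k i = β i := by
    intro i
    induction i using Nat.strong_induction_on with
    | _ i ih =>
    intro k hik
    by_contra hne
    have hex : ∃ l, k ≤ l ∧ g (l + 1) i = β i := ⟨max k N, le_max_left _ _,
      h.top _ (by have := le_max_right k N; omega) i⟩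
    classical
    set l := Nat.find hex with hl
    obtain ⟨hkl, hl1⟩ := Nat.find_spec hex
    have hl2 : g l i ≠ β i := by
      rcases Nat.eq_or_lt_of_le hkl with h1 | h1
      · rw [hl, ← h1]; exact hne
      · have := Nat.find_min hex (m := l - 1) (by omega)
        rw [show l - 1 + 1 = l by omega] at this
        exact fun hc => this ⟨by omega, hc⟩
    have hlN : l < N := by
      by_contra hc
      exact hl2 (h.top l (by omega) i)
    obtain ⟨t, ht⟩ : ∃ t, l = t + 1 := ⟨l - 1, by omega⟩
    have hlt : g l i < β i := lt_of_le_of_ne (h.le_shape l i) hl2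
    have hd := hd (β i - 1) t (by omega)
    unfold DomAt at hd
    rw [← hl, ht] at hl1
    rw [ht] at hlt
    have hs : ∀ i' ∈ Finset.range N,
        2 * (g (t + 1) i' - (β i - 1)) + (if i' = i then 1 else 0) ≤
          (g (t + 2) i' - (β i - 1)) + (g t i' - (β i - 1)) := by
      intro i' _
      rcases lt_trichotomy i' i with hi | hi | hi
      · rw [ih i' hi (t + 2) (by omega), ih i' hi (t + 1) (by omega), ih i' hi t (by omega)]
        split_ifs <;> omega
      · subst hi
        have := h.mono t i'
        rw [show t + 1 + 1 = t + 2 from rfl] at *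
        simp only [if_true]
        omega
      · have a1 := h.anti (t + 1) hi.le
        rw [if_neg (by omega)]
        omega
    have hsum := Finset.sum_le_sum hs
    rw [Finset.sum_add_distrib, Finset.sum_add_distrib, ← Finset.mul_sum, Finset.sum_ite_eq',
      if_pos (Finset.mem_range.2 (by omega))] at hsum
    unfold excess at hd
    beta_reduce at hd
    omega
  funext k i
  unfold highest
  split_ifs with hi
  · exact key i k hi
  · exact h.eq_zero (by omega)

end HighestWeight

/-! ### Alternants and Schur polynomials -/

section Alternant

open MvPolynomial

variable {N : ℕ}

/-- The monomial with exponents `v`. -/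
noncomputable def mono (v : Fin N → ℕ) : MvPolynomial (Fin N) ℚ := ∏ i, X i ^ v i

theorem mono_add (v w : Fin N → ℕ) : mono (v + w) = mono v * mono w := by
  simp [mono, pow_add, Finset.prod_mul_distrib]

theorem rename_mono (σ : Equiv.Perm (Fin N)) (v : Fin N → ℕ) :
    rename σ (mono v) = ∏ i, X (σ i) ^ v i := by
  simp [mono, map_prod]

theorem rename_mono_eq (σ : Equiv.Perm (Fin N)) (v : Fin N → ℕ) :
    rename σ (mono v) = mono (v ∘ σ.symm) := by
  rw [rename_mono, mono, ← Equiv.prod_comp σ fun i => (X i : MvPolynomial (Fin N) ℚ) ^ _]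
  simp

/-- The alternant `det (X i ^ v j)`. -/
noncomputable def alt (v : Fin N → ℕ) : MvPolynomial (Fin N) ℚ :=
  (Matrix.of fun i j => (X i : MvPolynomial (Fin N) ℚ) ^ v j).det

theorem alt_eq_sum (v : Fin N → ℕ) :
    alt v = ∑ σ : Equiv.Perm (Fin N), Equiv.Perm.sign σ • rename σ (mono v) := by
  simp only [alt, Matrix.det_apply, rename_mono, Matrix.of_apply]

theorem alt_comp_swap (v : Fin N → ℕ) {a b : Fin N} (hab : a ≠ b) :
    alt (v ∘ Equiv.swap a b) = - alt v := by
  have := Matrix.det_permute' (Equiv.swap a b)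
    (Matrix.of fun i j => (X i : MvPolynomial (Fin N) ℚ) ^ v j)
  rw [Equiv.Perm.sign_swap hab] at this
  simp only [Units.val_neg, Units.val_one, Int.cast_neg, Int.cast_one, neg_mul, one_mul] at this
  exact this

theorem alt_eq_zero_of_comp_swap {v : Fin N → ℕ} {a b : Fin N} (hab : a ≠ b)
    (h : v ∘ Equiv.swap a b = v) : alt v = 0 := by
  have := alt_comp_swap v hab
  rw [h] at this
  exact self_eq_neg.1 this

/-- The alternant of the staircase is the Vandermonde determinant, up to sign. -/
theorem alt_stair_ne_zero : alt (fun i : Fin N => stair N i) ≠ 0 := by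
  have h1 := Matrix.det_permute' (Fin.revPerm : Equiv.Perm (Fin N))
    (Matrix.of fun i j : Fin N => (X i : MvPolynomial (Fin N) ℚ) ^ (stair N j))
  have h2 : (Matrix.of fun i j : Fin N => (X i : MvPolynomial (Fin N) ℚ) ^ (stair N j)).submatrix id
      (Fin.revPerm : Equiv.Perm (Fin N)) = Matrix.vandermonde X := by
    ext1 i j
    have : N - 1 - (N - (j.1 + 1)) = j.1 := by omega
    simp [Matrix.vandermonde_apply, stair, Fin.val_rev, this]
  rw [h2] at h1
  intro h0
  rw [alt] at h0
  rw [h0, mul_zero] at h1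
  exact Matrix.det_vandermonde_ne_zero_iff.2 (X_injective) h1

/-- The Schur polynomial of shape `β` in `N` variables. -/
noncomputable def schurPoly (N : ℕ) (β : ℕ → ℕ) : MvPolynomial (Fin N) ℚ :=
  ∑ g ∈ patterns N β, mono fun i : Fin N => wt N g i

theorem rename_swap_schurPoly {k : ℕ} (hk : k + 1 < N) {β : ℕ → ℕ} (hβ : Antitone β) :
    rename (Equiv.swap (⟨k, by omega⟩ : Fin N) ⟨k + 1, hk⟩) (schurPoly N β) = schurPoly N β := by
  have hj : ∀ i, β i ≤ β 0 := fun i => hβ (Nat.zero_le i)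
  unfold schurPoly
  rw [map_sum]
  refine Finset.sum_bij' (fun g _ => toggle (β 0) k g) (fun g _ => toggle (β 0) k g) ?_ ?_ ?_ ?_ ?_
  · intro g hg
    exact mem_patterns.2 ((mem_patterns.1 hg).toggle _ hk)
  · intro g hg
    exact mem_patterns.2 ((mem_patterns.1 hg).toggle _ hk)
  · intro g hg
    exact toggle_toggle (mem_patterns.1 hg) _ _
  · intro g hg
    exact toggle_toggle (mem_patterns.1 hg) _ _
  · intro g hg
    have hw := wt_toggle_full (mem_patterns.1 hg) hk hj
    rw [rename_mono_eq]
    congr 1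
    funext i
    simp only [Function.comp, Equiv.symm_swap, Equiv.swap_apply_def]
    split_ifs with h1 h2
    · rw [h1]; exact hw.1.symm
    · rw [h2]; exact hw.2.symm
    · rw [wt_toggle_of_ne]
      · exact fun hc => h1 (Fin.ext hc)
      · exact fun hc => h2 (Fin.ext hc)

theorem rename_schurPoly (σ : Equiv.Perm (Fin N)) {β : ℕ → ℕ} (hβ : Antitone β) :
    rename σ (schurPoly N β) = schurPoly N β := by
  cases N with
  | zero =>
    rw [Subsingleton.elim σ 1]
    exact rename_id_apply _
  | succ n =>
    have hσ : σ ∈ Submonoid.closure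
        (Set.range fun i : Fin n => Equiv.swap i.castSucc i.succ) := by
      rw [Equiv.Perm.mclosure_swap_castSucc_succ]; trivial
    induction hσ using Submonoid.closure_induction with
    | mem x hx =>
      obtain ⟨i, rfl⟩ := hx
      exact rename_swap_schurPoly (k := i) (by omega) hβ
    | one => exact rename_id_apply _
    | mul x y _ _ hx hy =>
      rw [Equiv.Perm.coe_mul, ← rename_rename, hy, hx]

theorem alt_mul_schurPoly (v : Fin N → ℕ) {β : ℕ → ℕ} (hβ : Antitone β) :
    alt v * schurPoly N β = ∑ g ∈ patterns N β, alt (v + fun i : Fin N => wt N g i) := by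
  simp only [alt_eq_sum]
  rw [Finset.sum_mul, Finset.sum_comm]
  refine Finset.sum_congr rfl fun σ _ => ?_
  rw [← Finset.smul_sum, ← map_sum]
  simp only [mono_add]
  rw [← Finset.mul_sum, map_mul, smul_mul_assoc]
  congr 2
  exact (rename_schurPoly σ hβ).symm

open Classical in
/-- The alternants of the patterns that are not dominant cancel: toggling a pattern at its defect
exchanges two adjacent exponents. -/
theorem sum_alt_not_dominant {β μ : ℕ → ℕ} (hμ : Antitone μ) :
    ∑ g ∈ patterns N β with ¬ Dominant N μ g,
      alt (fun i : Fin N => μ i + stair N i + wt N g i) = 0 := by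
  have hex : ∀ g ∈ (patterns N β).filter (fun g => ¬ Dominant N μ g), ∃ p, IsDefect N μ g p :=
    fun g hg => exists_isDefect (mem_patterns.1 (Finset.mem_filter.1 hg).1) hμ
      (Finset.mem_filter.1 hg).2
  choose! d hd using hex
  have hpat : ∀ g ∈ (patterns N β).filter (fun g => ¬ Dominant N μ g), IsPattern N β g :=
    fun g hg => mem_patterns.1 (Finset.mem_filter.1 hg).1
  have hmem : ∀ g ∈ (patterns N β).filter (fun g => ¬ Dominant N μ g),
      toggle (d g).1 (d g).2 g ∈ (patterns N β).filter (fun g => ¬ Dominant N μ g) := by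
    intro g hg
    have h1 := (hd g hg).toggle (hpat g hg)
    exact Finset.mem_filter.2 ⟨mem_patterns.2 ((hpat g hg).toggle _ (hd g hg).1),
      fun hc => h1.2.1 (hc _ _ h1.1)⟩
  have hswap : ∀ g (hg : g ∈ (patterns N β).filter (fun g => ¬ Dominant N μ g)),
      (fun i : Fin N => μ i + stair N i + wt N (toggle (d g).1 (d g).2 g) i) =
        (fun i : Fin N => μ i + stair N i + wt N g i) ∘
          Equiv.swap ⟨(d g).2, Nat.lt_of_succ_lt (hd g hg).1⟩ ⟨(d g).2 + 1, (hd g hg).1⟩ := by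
    intro g hg
    have hw := (hd g hg).add_wt_toggle (hpat g hg)
    funext i
    simp only [Function.comp, Equiv.swap_apply_def]
    split_ifs with h1 h2
    · rw [h1]; exact hw.1
    · rw [h2]; exact hw.2
    · rw [wt_toggle_of_ne]
      · exact fun hc => h1 (Fin.ext hc)
      · exact fun hc => h2 (Fin.ext hc)
  have hne : ∀ g (hg : g ∈ (patterns N β).filter (fun g => ¬ Dominant N μ g)),
      (⟨(d g).2, Nat.lt_of_succ_lt (hd g hg).1⟩ : Fin N) ≠ ⟨(d g).2 + 1, (hd g hg).1⟩ := by
    intro g hg hc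
    simp at hc
  refine Finset.sum_involution (fun g _ => toggle (d g).1 (d g).2 g) ?_ ?_ ?_ ?_
  · intro g hg
    rw [hswap g hg, alt_comp_swap _ (hne g hg), add_neg_cancel]
  · intro g hg h0 hc
    refine h0 (alt_eq_zero_of_comp_swap (hne g hg) ?_)
    rw [← hswap g hg, hc]
  · exact hmem
  · intro g hg
    have h1 := (hd g hg).toggle (hpat g hg)
    have h2 := (hd _ (hmem g hg)).unique h1
    rw [h2]
    exact toggle_toggle (hpat g hg) _ _

open Classical in
theorem alt_mul_schurPoly_eq_sum_dominant {β μ : ℕ → ℕ} (hμ : Antitone μ) (hβ : Antitone β) :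
    alt (fun i : Fin N => μ i + stair N i) * schurPoly N β =
      ∑ g ∈ patterns N β with Dominant N μ g,
        alt (fun i : Fin N => μ i + stair N i + wt N g i) := by
  rw [alt_mul_schurPoly _ hβ, ← Finset.sum_filter_add_sum_filter_not _ (fun g => Dominant N μ g)]
  have := sum_alt_not_dominant (N := N) (β := β) hμ
  simp only [Pi.add_def]
  rw [this, add_zero]

/-- The bialternant formula. -/
theorem alt_stair_mul_schurPoly {β : ℕ → ℕ} (hβ : Antitone β) (hN : ∀ i, N ≤ i → β i = 0) :
    alt (fun i : Fin N => stair N i) * schurPoly N β = alt fun i : Fin N => β i + stair N i := by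
  classical
  have h := alt_mul_schurPoly_eq_sum_dominant (N := N) (β := β) (μ := fun _ => 0)
    (fun _ _ _ => le_rfl) hβ
  simp only [zero_add] at h
  rw [h, Finset.sum_eq_single (highest β)]
  · congr 1
    funext i
    rw [wt_highest i.2, add_comm]
  · intro g hg hne
    rw [Finset.mem_filter, mem_patterns] at hg
    exact absurd (Dominant.eq_highest hg.1 hg.2) hne
  · intro hg
    exact absurd (Finset.mem_filter.2 ⟨mem_patterns.2 (isPattern_highest hβ hN),
      dominant_highest hβ⟩) hg

/-- The partition obtained by adding the content of a tableau to `μ`. -/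
def addWt (N : ℕ) (μ : ℕ → ℕ) (g : ℕ → ℕ → ℕ) (k : ℕ) : ℕ :=
  if k < N then μ k + wt N g k else 0

theorem Dominant.antitone_addWt {β μ : ℕ → ℕ} {g : ℕ → ℕ → ℕ} (h : IsPattern N β g)
    (hd : Dominant N μ g) : Antitone (addWt N μ g) := by
  refine antitone_nat_of_succ_le fun k => ?_
  unfold addWt wt
  split_ifs with h1 h2
  · have := hd 0 k h1
    unfold DomAt at this
    have := h.excess_mono 0 k
    have := h.excess_mono 0 (k + 1)
    rw [show k + 1 + 1 = k + 2 from rfl] at *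
    omega
  · omega
  · omega
  · omega

open Classical in
/-- The Littlewood–Richardson rule for Schur polynomials. -/
theorem schurPoly_mul_schurPoly {β μ : ℕ → ℕ} (hμ : Antitone μ) (hβ : Antitone β)
    (hN : ∀ i, N ≤ i → μ i = 0) :
    schurPoly N μ * schurPoly N β =
      ∑ g ∈ patterns N β with Dominant N μ g, schurPoly N (addWt N μ g) := by
  refine mul_left_cancel₀ (alt_stair_ne_zero (N := N)) ?_
  rw [← mul_assoc, alt_stair_mul_schurPoly hμ hN, alt_mul_schurPoly_eq_sum_dominant hμ hβ,
    Finset.mul_sum]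
  refine Finset.sum_congr rfl fun g hg => ?_
  rw [Finset.mem_filter, mem_patterns] at hg
  rw [alt_stair_mul_schurPoly (hg.2.antitone_addWt hg.1)]
  · congr 1
    funext i
    simp only [addWt, if_pos i.2]
    omega
  · intro i hi
    simp [addWt, not_lt.2 hi]

end Alternant

/-! ### Semistandard tableaux as patterns -/

section Tableaux

theorem lt_card_filter_range_iff {n c : ℕ} {P : ℕ → Prop} [DecidablePred P]
    (hP : ∀ a b, a ≤ b → b < n → P b → P a) :
    c < ((Finset.range n).filter P).card ↔ c < n ∧ P c := by
  constructor
  · intro h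
    by_contra hc
    have hsub : (Finset.range n).filter P ⊆ Finset.range c := by
      intro b hb
      rw [Finset.mem_filter, Finset.mem_range] at hb
      rw [Finset.mem_range]
      by_contra hbc
      exact hc ⟨by omega, hP c b (by omega) hb.1 hb.2⟩
    have := Finset.card_le_card hsub
    rw [Finset.card_range] at this
    omega
  · rintro ⟨h1, h2⟩
    have hsub : Finset.range (c + 1) ⊆ (Finset.range n).filter P := by
      intro b hb
      rw [Finset.mem_range] at hb
      rw [Finset.mem_filter, Finset.mem_range]
      exact ⟨by omega, hP b c (by omega) h1 h2⟩
    have := Finset.card_le_card hsub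
    rw [Finset.card_range] at this
    omega

variable {μ : YoungDiagram} {N : ℕ}

/-- The pattern of a tableau. -/
def levels (T : SemistandardYoungTableau μ) (k i : ℕ) : ℕ :=
  ((Finset.range (μ.rowLen i)).filter fun c => T i c < k).card

theorem lt_levels_iff (T : SemistandardYoungTableau μ) {k i c : ℕ} :
    c < levels T k i ↔ (i, c) ∈ μ ∧ T i c < k := by
  rw [YoungDiagram.mem_iff_lt_rowLen]
  exact lt_card_filter_range_iff fun a b hab hb h =>
    (T.row_weak_of_le hab (YoungDiagram.mem_iff_lt_rowLen.2 hb)).trans_lt h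

theorem isPattern_levels {T : SemistandardYoungTableau μ} (hT : ∀ i c, (i, c) ∈ μ → T i c < N) :
    IsPattern N μ.rowLen (levels T) where
  zero i := by simp [levels]
  mono k i := le_of_forall_lt fun c hc => by
    rw [lt_levels_iff] at hc ⊢
    exact ⟨hc.1, by omega⟩
  inter k i := le_of_forall_lt fun c hc => by
    rw [lt_levels_iff] at hc ⊢
    have := T.col_strict (show i < i + 1 by omega) hc.1
    exact ⟨μ.up_left_mem (Nat.le_succ i) le_rfl hc.1, by omega⟩
  top k hk i := by
    unfold levels
    rw [Finset.filter_true_of_mem, Finset.card_range]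
    intro c hc
    have := hT i c (YoungDiagram.mem_iff_lt_rowLen.2 (Finset.mem_range.1 hc))
    omega

theorem levels_injective : Function.Injective (levels (μ := μ)) := by
  intro T T' h
  ext i c
  by_cases hc : (i, c) ∈ μ
  · have key : ∀ k, T i c < k ↔ T' i c < k := by
      intro k
      have h1 := lt_levels_iff T (k := k) (i := i) (c := c)
      rw [h, lt_levels_iff] at h1
      simpa [hc] using h1.symm
    have h1 := key (T i c + 1)
    have h2 := key (T' i c + 1)
    omega
  · rw [T.zeros hc, T'.zeros hc]

theorem card_filter_cells_lt (T : SemistandardYoungTableau μ) (k : ℕ)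
    (hN : ∀ i, N ≤ i → μ.rowLen i = 0) :
    (μ.cells.filter fun c => T c.1 c.2 < k).card = excess N (levels T) 0 k := by
  have hmaps : ∀ c ∈ μ.cells.filter (fun c => T c.1 c.2 < k), c.1 ∈ Finset.range N := by
    intro c hc
    rw [Finset.mem_filter, YoungDiagram.mem_cells, YoungDiagram.mem_iff_lt_rowLen] at hc
    rw [Finset.mem_range]
    by_contra h
    rw [hN c.1 (by omega)] at hc
    omega
  rw [Finset.card_eq_sum_card_fiberwise hmaps]
  refine Finset.sum_congr rfl fun i _ => ?_
  rw [Nat.sub_zero, levels]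
  refine (Finset.card_bij (fun c _ => (i, c)) ?_ ?_ ?_).symm
  · intro c hc
    rw [Finset.mem_filter, Finset.mem_range] at hc
    simp only [Finset.mem_filter, YoungDiagram.mem_cells, YoungDiagram.mem_iff_lt_rowLen]
    exact ⟨hc, trivial⟩
  · intro c _ c' _ h
    exact congrArg Prod.snd h
  · rintro ⟨i', c⟩ hc
    simp only [Finset.mem_filter, YoungDiagram.mem_cells, YoungDiagram.mem_iff_lt_rowLen] at hc
    obtain ⟨hc, rfl⟩ := hc
    exact ⟨c, Finset.mem_filter.2 ⟨Finset.mem_range.2 hc.1, hc.2⟩, rfl⟩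

theorem card_filter_cells_eq (T : SemistandardYoungTableau μ) (k : ℕ)
    (hN : ∀ i, N ≤ i → μ.rowLen i = 0) :
    (μ.cells.filter fun c => T c.1 c.2 = k).card = wt N (levels T) k := by
  unfold wt
  rw [← card_filter_cells_lt T _ hN, ← card_filter_cells_lt T _ hN]
  have : (μ.cells.filter fun c => T c.1 c.2 < k + 1) =
      (μ.cells.filter fun c => T c.1 c.2 < k) ∪ (μ.cells.filter fun c => T c.1 c.2 = k) := by
    rw [← Finset.filter_or]
    refine Finset.filter_congr fun c _ => ?_
    omega
  rw [this, Finset.card_union_of_disjoint]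
  · omega
  · rw [Finset.disjoint_filter]
    intro c _ h
    omega

/-- The tableau of a pattern: the entry of a cell is the first letter whose level contains it. -/
noncomputable def ofPattern {g : ℕ → ℕ → ℕ} (h : IsPattern N μ.rowLen g) :
    SemistandardYoungTableau μ where
  entry i c := sInf {l | c < g (l + 1) i}
  row_weak' := by
    intro i c1 c2 hc hcell
    refine Nat.sInf_le ?_
    have hne : {l | c2 < g (l + 1) i}.Nonempty := ⟨N, by
      change c2 < g (N + 1) i
      rw [h.top _ (Nat.le_succ N)]
      exact YoungDiagram.mem_iff_lt_rowLen.1 hcell⟩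
    exact hc.trans (Nat.sInf_mem hne)
  col_strict' := by
    intro i1 i2 c hi hcell
    have hne : {l | c < g (l + 1) i2}.Nonempty := ⟨N, by
      change c < g (N + 1) i2
      rw [h.top _ (Nat.le_succ N)]
      exact YoungDiagram.mem_iff_lt_rowLen.1 hcell⟩
    have hmem : c < g (sInf {l | c < g (l + 1) i2} + 1) i2 := Nat.sInf_mem hne
    set l := sInf {l | c < g (l + 1) i2}
    have h1 : c < g (l + 1) (i1 + 1) := hmem.trans_le (h.anti _ hi)
    have h2 : c < g l i1 := h1.trans_le (h.inter l i1)
    obtain ⟨t, ht⟩ : ∃ t, l = t + 1 := by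
      refine ⟨l - 1, ?_⟩
      rcases Nat.eq_zero_or_pos l with h0 | h0
      · rw [h0, h.zero] at h2
        omega
      · omega
    rw [ht] at h2 ⊢
    exact Nat.lt_succ_of_le (Nat.sInf_le h2)
  zeros' := by
    intro i c hcell
    have : {l | c < g (l + 1) i} = ∅ := by
      refine Set.eq_empty_of_forall_notMem fun l hl => hcell ?_
      exact YoungDiagram.mem_iff_lt_rowLen.2 (lt_of_lt_of_le hl (h.le_shape _ _))
    rw [this, Nat.sInf_empty]

theorem ofPattern_lt_iff {g : ℕ → ℕ → ℕ} (h : IsPattern N μ.rowLen g) {i c k : ℕ}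
    (hc : (i, c) ∈ μ) : ofPattern h i c < k ↔ c < g k i := by
  have hne : {l | c < g (l + 1) i}.Nonempty := ⟨N, by
    change c < g (N + 1) i
    rw [h.top _ (Nat.le_succ N)]
    exact YoungDiagram.mem_iff_lt_rowLen.1 hc⟩
  have hmem : c < g (ofPattern h i c + 1) i := Nat.sInf_mem hne
  constructor
  · intro hk
    exact hmem.trans_le (h.mono_le hk i)
  · intro hk
    cases k with
    | zero =>
      rw [h.zero] at hk
      omega
    | succ k => exact Nat.lt_succ_of_le (Nat.sInf_le hk)

theorem levels_ofPattern {g : ℕ → ℕ → ℕ} (h : IsPattern N μ.rowLen g) :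
    levels (ofPattern h) = g := by
  funext k i
  refine eq_of_forall_lt_iff fun c => ?_
  rw [lt_levels_iff]
  constructor
  · rintro ⟨h1, h2⟩
    exact (ofPattern_lt_iff h h1).1 h2
  · intro hc
    have h1 : (i, c) ∈ μ := YoungDiagram.mem_iff_lt_rowLen.2 (hc.trans_le (h.le_shape _ _))
    exact ⟨h1, (ofPattern_lt_iff h h1).2 hc⟩

theorem wt_eq_zero {β : ℕ → ℕ} {g : ℕ → ℕ → ℕ} (h : IsPattern N β g) {k : ℕ} (hk : N ≤ k) :
    wt N g k = 0 := by
  unfold wt excess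
  simp [h.top k hk, h.top (k + 1) (by omega)]

theorem ncard_tableauxOfContent (d : ℕ →₀ ℕ) (hd : ∀ k, N ≤ k → d k = 0) :
    (tableauxOfContent μ d).ncard =
      {g | IsPattern N μ.rowLen g ∧ ∀ k < N, wt N g k = d k}.ncard := by
  have hsmall : ∀ T ∈ tableauxOfContent μ d, ∀ i c, (i, c) ∈ μ → T i c < N := by
    intro T hT i c hc
    by_contra hlt
    have h1 := hT (T i c)
    rw [hd _ (not_lt.1 hlt), Finset.card_eq_zero] at h1
    have : (i, c) ∈ μ.cells.filter fun x => T x.1 x.2 = T i c := by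
      simpa using hc
    rw [h1] at this
    simp at this
  refine Set.ncard_congr (fun T _ => levels T) ?_ ?_ ?_
  · intro T hT
    have hp := isPattern_levels (hsmall T hT)
    refine ⟨hp, fun k _ => ?_⟩
    rw [← hT k]
    exact (card_filter_cells_eq T k fun i hi => hp.shape_eq_zero hi).symm
  · intro T T' _ _ h
    exact levels_injective h
  · rintro g ⟨hg, hw⟩
    refine ⟨ofPattern hg, fun k => ?_, levels_ofPattern hg⟩
    rw [card_filter_cells_eq _ k fun i hi => hg.shape_eq_zero hi, levels_ofPattern]
    rcases lt_or_ge k N with hk | hk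
    · exact hw k hk
    · rw [wt_eq_zero hg hk, hd k hk]

end Tableaux

/-! ### From Schur polynomials to Schur functions -/

section Link

open MvPolynomial

theorem mono_eq_monomial {N : ℕ} (v : Fin N → ℕ) :
    mono v = monomial (Finsupp.equivFunOnFinite.symm v) 1 := by
  rw [monomial_eq, map_one, one_mul, mono, Finsupp.prod_fintype _ _ (by simp)]
  rfl

theorem coeff_schurPoly {N : ℕ} (β : ℕ → ℕ) (e : Fin N →₀ ℕ) :
    coeff e (schurPoly N β) =
      ({g | IsPattern N β g ∧ ∀ k : Fin N, wt N g k = e k}.ncard : ℚ) := by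
  classical
  unfold schurPoly
  rw [coeff_sum]
  simp only [mono_eq_monomial, coeff_monomial]
  rw [Finset.sum_boole, ← Set.ncard_coe_finset]
  congr 2
  ext g
  simp [DFunLike.ext_iff]

/-- The part of a Schur function involving only the first `N` variables is the Schur polynomial. -/
theorem coeff_schur {N : ℕ} (μ : YoungDiagram) (d : ℕ →₀ ℕ) (hd : ∀ k, N ≤ k → d k = 0) :
    MvPowerSeries.coeff d (schur μ) =
      coeff d (rename (Fin.val : Fin N → ℕ) (schurPoly N μ.rowLen)) := by
  obtain ⟨e, rfl⟩ : ∃ e : Fin N →₀ ℕ, Finsupp.mapDomain Fin.val e = d := by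
    refine ⟨d.comapDomain Fin.val Fin.val_injective.injOn, ?_⟩
    refine Finsupp.mapDomain_comapDomain _ Fin.val_injective _ ?_
    intro k hk
    by_contra hc
    have : N ≤ k := by
      by_contra h
      exact hc ⟨⟨k, by omega⟩, rfl⟩
    exact (Finsupp.mem_support_iff.1 hk) (hd k this)
  rw [coeff_rename_mapDomain _ Fin.val_injective, coeff_schurPoly]
  change ((tableauxOfContent μ _).ncard : ℚ) = _
  rw [ncard_tableauxOfContent _ hd]
  congr 3
  ext g
  refine and_congr_right fun _ => ⟨fun h k => ?_, fun h k hk => ?_⟩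
  · rw [h k k.2, Finsupp.mapDomain_apply Fin.val_injective]
  · have := h ⟨k, hk⟩
    rw [← Finsupp.mapDomain_apply Fin.val_injective e] at this
    exact this

theorem coeff_schur_mul_schur {N : ℕ} (μ ν : YoungDiagram) (d : ℕ →₀ ℕ)
    (hd : ∀ k, N ≤ k → d k = 0) :
    MvPowerSeries.coeff d (schur μ * schur ν) =
      coeff d (rename (Fin.val : Fin N → ℕ) (schurPoly N μ.rowLen * schurPoly N ν.rowLen)) := by
  classical
  rw [map_mul (rename _), MvPowerSeries.coeff_mul, coeff_mul]
  refine Finset.sum_congr rfl fun p hp => ?_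
  rw [Finset.HasAntidiagonal.mem_antidiagonal] at hp
  have hle : ∀ k, N ≤ k → p.1 k = 0 ∧ p.2 k = 0 := by
    intro k hk
    have := hd k hk
    rw [← hp, Finsupp.add_apply] at this
    omega
  rw [coeff_schur (N := N) μ _ fun k hk => (hle k hk).1,
    coeff_schur (N := N) ν _ fun k hk => (hle k hk).2]

end Link

/-! ### Partitions as sequences of row lengths -/

section Rows

variable {n : ℕ}

theorem rowLens_diagram (p : n.Partition) : (diagram p).rowLens = p.parts.sort (· ≥ ·) :=
  YoungDiagram.rowLens_ofRowLens_eq_self fun x hx => p.parts_pos (by simpa using hx)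

theorem diagram_injective : Function.Injective (diagram (n := n)) := by
  intro p q h
  have h1 := rowLens_diagram p
  rw [h, rowLens_diagram] at h1
  have h2 := congrArg (fun l : List ℕ => (l : Multiset ℕ)) h1
  simp only [Multiset.sort_eq] at h2
  exact Nat.Partition.ext h2.symm

theorem rowLen_injective : Function.Injective YoungDiagram.rowLen := by
  intro μ ν h
  ext ⟨i, j⟩
  rw [YoungDiagram.mem_cells, YoungDiagram.mem_cells, YoungDiagram.mem_iff_lt_rowLen,
    YoungDiagram.mem_iff_lt_rowLen, h]

theorem rowLen_eq_zero_of_colLen_le {μ : YoungDiagram} {i : ℕ} (hi : μ.colLen 0 ≤ i) :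
    μ.rowLen i = 0 := by
  by_contra h
  have : (i, 0) ∈ μ := YoungDiagram.mem_iff_lt_rowLen.2 (Nat.pos_of_ne_zero h)
  rw [YoungDiagram.mem_iff_lt_colLen] at this
  omega

theorem sum_rowLens (μ : YoungDiagram) :
    μ.rowLens.sum = ∑ i ∈ Finset.range (μ.colLen 0), μ.rowLen i := by
  rw [YoungDiagram.rowLens, Finset.sum_range]
  rw [← List.sum_ofFn]
  congr 1
  refine List.ext_getElem (by simp) fun i h1 h2 => by simp

theorem sum_rowLen_of_le {μ : YoungDiagram} {N : ℕ} (hN : μ.colLen 0 ≤ N) :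
    ∑ i ∈ Finset.range N, μ.rowLen i = μ.rowLens.sum := by
  rw [sum_rowLens]
  refine (Finset.sum_subset (Finset.range_mono hN) fun i _ hi => ?_).symm
  exact rowLen_eq_zero_of_colLen_le (by simpa using hi)

theorem colLen_le_sum_rowLens (μ : YoungDiagram) : μ.colLen 0 ≤ μ.rowLens.sum := by
  rw [sum_rowLens]
  calc μ.colLen 0 = ∑ i ∈ Finset.range (μ.colLen 0), 1 := by simp
    _ ≤ _ := Finset.sum_le_sum fun i hi => by
      have := YoungDiagram.mem_iff_lt_colLen.2 (Finset.mem_range.1 hi)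
      rw [YoungDiagram.mem_iff_lt_rowLen] at this
      omega

theorem sum_rowLens_diagram (p : n.Partition) : (diagram p).rowLens.sum = n := by
  rw [rowLens_diagram, ← Multiset.sum_coe, Multiset.sort_eq, p.parts_sum]

theorem colLen_diagram_le (p : n.Partition) : (diagram p).colLen 0 ≤ n :=
  (colLen_le_sum_rowLens _).trans_eq (sum_rowLens_diagram p)

theorem rowLen_diagram_eq_zero (p : n.Partition) {i : ℕ} (hi : n ≤ i) :
    (diagram p).rowLen i = 0 :=
  rowLen_eq_zero_of_colLen_le ((colLen_diagram_le p).trans hi)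

theorem sum_rowLen_diagram (p : n.Partition) {N : ℕ} (hN : n ≤ N) :
    ∑ i ∈ Finset.range N, (diagram p).rowLen i = n := by
  rw [sum_rowLen_of_le ((colLen_diagram_le p).trans hN), sum_rowLens_diagram]

theorem rowLen_antitone (μ : YoungDiagram) : Antitone μ.rowLen :=
  fun i j hij => μ.rowLen_anti i j hij

/-- Every partition given by its sequence of parts is the diagram of an element of `Nat.Partition`. -/
theorem exists_rowLen_diagram_eq {f : ℕ → ℕ} (hf : Antitone f) {N : ℕ} (h0 : ∀ i, N ≤ i → f i = 0)
    (hsum : ∑ i ∈ Finset.range N, f i = n) : ∃ p : n.Partition, (diagram p).rowLen = f := by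
  let μ : YoungDiagram :=
    { cells := (Finset.range N ×ˢ Finset.range (f 0)).filter fun c => c.2 < f c.1
      isLowerSet := by
        rintro ⟨i, j⟩ ⟨i', j'⟩ ⟨hi, hj⟩ hc
        simp only [Finset.coe_filter, Finset.mem_product, Finset.mem_range] at hc hi hj ⊢
        have h1 := hf hi
        exact ⟨⟨lt_of_le_of_lt hi hc.1.1, lt_of_le_of_lt hj hc.1.2⟩, by
          have := hc.2
          simp only at h1 this ⊢
          omega⟩ }
  have hμ : μ.rowLen = f := by
    funext i
    refine eq_of_forall_lt_iff fun j => ?_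
    rw [← YoungDiagram.mem_iff_lt_rowLen, ← YoungDiagram.mem_cells]
    simp only [μ, Finset.mem_filter, Finset.mem_product, Finset.mem_range]
    refine ⟨fun h => h.2, fun h => ⟨⟨?_, h.trans_le (hf (Nat.zero_le i))⟩, h⟩⟩
    by_contra hc
    rw [h0 i (by omega)] at h
    omega
  have hcol : μ.colLen 0 ≤ N := by
    by_contra hc
    have := YoungDiagram.mem_iff_lt_colLen.2 (not_le.1 hc)
    rw [YoungDiagram.mem_iff_lt_rowLen, hμ, h0 N le_rfl] at this
    omega
  let p : n.Partition :=
    { parts := (μ.rowLens : Multiset ℕ)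
      parts_pos := fun {x} hx => μ.pos_of_mem_rowLens x (by simpa using hx)
      parts_sum := by
        rw [Multiset.sum_coe, ← sum_rowLen_of_le hcol, hμ, hsum] }
  refine ⟨p, ?_⟩
  have hsort : p.parts.sort (· ≥ ·) = μ.rowLens := by
    have h1 : (p.parts.sort (· ≥ ·)).Perm μ.rowLens := by
      rw [← Multiset.coe_eq_coe, Multiset.sort_eq]
    exact h1.eq_of_pairwise' (Multiset.pairwise_sort _ _) μ.rowLens_sorted.pairwise
  have : diagram p = μ := by
    unfold diagram
    conv_rhs => rw [← YoungDiagram.ofRowLens_to_rowLens_eq_self (μ := μ)]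
    congr 1
  rw [this, hμ]

end Rows

/-! ### The Littlewood–Richardson rule for Schur functions -/

section Product

variable {n N : ℕ} {α β : ℕ → ℕ} {g : ℕ → ℕ → ℕ}

theorem excess_eq_of_le (hle : ∀ k i, g k i ≤ β i) (hβ : ∀ i, n ≤ i → β i = 0) (hN : n ≤ N)
    (j k : ℕ) : excess N g j k = excess n g j k := by
  refine (Finset.sum_subset (Finset.range_mono hN) fun i _ hi => ?_).symm
  have h1 := hβ i (by simpa using hi)
  have h2 := hle k i
  omega

theorem sum_wt (h : IsPattern N β g) :
    ∑ k ∈ Finset.range N, wt N g k = ∑ i ∈ Finset.range N, β i := by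
  unfold wt
  rw [Finset.sum_range_tsub (monotone_nat_of_le_succ fun k => h.excess_mono 0 k)]
  unfold excess
  simp [h.zero, h.top N le_rfl]

theorem eq_zero_of_antitone_of_sum_le {f : ℕ → ℕ} (hf : Antitone f) {k : ℕ} (hk : n ≤ k)
    (hkN : k < N) (hsum : ∑ i ∈ Finset.range N, f i ≤ n) : f k = 0 := by
  by_contra h
  have h1 : ∑ i ∈ Finset.range (k + 1), 1 ≤ ∑ i ∈ Finset.range (k + 1), f i := by
    refine Finset.sum_le_sum fun i hi => ?_
    have := hf (Nat.lt_succ_iff.1 (Finset.mem_range.1 hi))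
    omega
  have h2 : ∑ i ∈ Finset.range (k + 1), f i ≤ ∑ i ∈ Finset.range N, f i :=
    Finset.sum_le_sum_of_subset (Finset.range_mono hkN)
  simp only [Finset.sum_const, Finset.card_range, smul_eq_mul, mul_one] at h1
  omega

theorem sum_addWt (h : IsPattern N β g) :
    ∑ k ∈ Finset.range N, addWt N α g k =
      ∑ i ∈ Finset.range N, α i + ∑ i ∈ Finset.range N, β i := by
  rw [← sum_wt h, ← Finset.sum_add_distrib]
  refine Finset.sum_congr rfl fun k hk => ?_
  rw [addWt, if_pos (Finset.mem_range.1 hk)]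

open Classical in
/-- The patterns of the Littlewood–Richardson rule. -/
noncomputable def lrPatterns (N : ℕ) (α β : ℕ → ℕ) : Finset (ℕ → ℕ → ℕ) :=
  (patterns N β).filter fun g => Dominant N α g

theorem mem_lrPatterns : g ∈ lrPatterns N α β ↔ IsPattern N β g ∧ Dominant N α g := by
  simp [lrPatterns]

theorem sum_range_eq_of_le {f : ℕ → ℕ} (h0 : ∀ i, n ≤ i → f i = 0) (hN : n ≤ N) :
    ∑ i ∈ Finset.range N, f i = ∑ i ∈ Finset.range n, f i :=
  (Finset.sum_subset (Finset.range_mono hN) fun i _ hi => h0 i (by simpa using hi)).symm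

/-- The Littlewood–Richardson patterns do not depend on the number of letters, as soon as this
is at least the total size. -/
theorem lrPatterns_eq (hα0 : ∀ i, n ≤ i → α i = 0) (hβ0 : ∀ i, n ≤ i → β i = 0)
    (hsum : ∑ i ∈ Finset.range n, α i + ∑ i ∈ Finset.range n, β i = n) (hN : n ≤ N) :
    lrPatterns N α β = lrPatterns n α β := by
  ext g
  rw [mem_lrPatterns, mem_lrPatterns]
  constructor
  · rintro ⟨h, hd⟩
    have hex := excess_eq_of_le h.le_shape hβ0 hN
    have hanti := hd.antitone_addWt h
    have hwt : ∀ k, n ≤ k → k < N → wt N g k = 0 := by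
      intro k hk hkN
      have := eq_zero_of_antitone_of_sum_le hanti hk hkN (by
        rw [sum_addWt h, sum_range_eq_of_le hα0 hN, sum_range_eq_of_le hβ0 hN, hsum])
      rw [addWt, if_pos hkN] at this
      omega
    have hstep : ∀ k, n ≤ k → ∀ i, g (k + 1) i = g k i := by
      intro k hk i
      rcases le_or_gt N k with hkN | hkN
      · rw [h.top k hkN, h.top (k + 1) (by omega)]
      · rcases le_or_gt n i with hi | hi
        · have h1 := h.le_shape (k + 1) i
          have h2 := h.le_shape k i
          rw [hβ0 i hi] at h1 h2
          omega
        · have h1 := hwt k hk hkN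
          have h2 := h.excess_mono 0 k
          have heq : excess N g 0 k = excess N g 0 (k + 1) := by
            unfold wt at h1
            omega
          have := (Finset.sum_eq_sum_iff_of_le fun i _ => Nat.sub_le_sub_right (h.mono k i) 0).1 heq
            i (Finset.mem_range.2 (by omega))
          simpa using this.symm
    have hconst : ∀ k, n ≤ k → ∀ i, g k i = g n i := by
      intro k hk i
      induction k, hk using Nat.le_induction with
      | base => rfl
      | succ k hk ih => rw [hstep k hk, ih]
    refine ⟨⟨h.zero, h.mono, h.inter, fun k hk i => ?_⟩, fun j k hk => ?_⟩
    · rw [hconst k hk, ← hconst N hN, h.top N le_rfl]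
    · have := hd j k (by omega)
      unfold DomAt at this ⊢
      simpa only [hex] using this
  · rintro ⟨h, hd⟩
    have hex := excess_eq_of_le h.le_shape hβ0 hN
    refine ⟨⟨h.zero, h.mono, h.inter, fun k hk i => h.top k (by omega) i⟩, fun j k hk => ?_⟩
    unfold DomAt
    simp only [hex]
    rcases lt_or_ge (k + 1) n with hkn | hkn
    · exact hd j k hkn
    · have h1 := h.excess_mono j k
      have h2 : excess n g j (k + 2) = excess n g j (k + 1) := by
        unfold excess
        simp only [h.top (k + 2) (by omega), h.top (k + 1) hkn]
      have h3 := hα0 (k + 1) hkn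
      omega

theorem addWt_eq (h : IsPattern n β g) (hα0 : ∀ i, n ≤ i → α i = 0)
    (hβ0 : ∀ i, n ≤ i → β i = 0) (hN : n ≤ N) : addWt N α g = addWt n α g := by
  have hex := excess_eq_of_le h.le_shape hβ0 hN
  funext k
  have hw : wt N g k = wt n g k := by simp only [wt, hex]
  unfold addWt
  rw [hw]
  split_ifs with h1 h2
  · rfl
  · rw [hα0 k (by omega), wt_eq_zero h (by omega)]
  · omega
  · rfl

open Classical in
/-- The Littlewood–Richardson coefficient: the number of Littlewood–Richardson patterns whose
content completes `α` to the partition `p`. -/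
noncomputable def lrCoeff (n : ℕ) (α β : YoungDiagram) (p : n.Partition) : ℕ :=
  ((lrPatterns n α.rowLen β.rowLen).filter
    fun g => addWt n α.rowLen g = (diagram p).rowLen).card

open Classical in
theorem schur_mul_schur {a b : ℕ} (α : a.Partition) (β : b.Partition) (hab : a + b = n) :
    schur (diagram α) * schur (diagram β) =
      ∑ p : n.Partition, (lrCoeff n (diagram α) (diagram β) p : ℚ) • schur (diagram p) := by
  have hα0 : ∀ i, n ≤ i → (diagram α).rowLen i = 0 :=
    fun i hi => rowLen_diagram_eq_zero α (by omega)
  have hβ0 : ∀ i, n ≤ i → (diagram β).rowLen i = 0 :=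
    fun i hi => rowLen_diagram_eq_zero β (by omega)
  have hsum : ∑ i ∈ Finset.range n, (diagram α).rowLen i +
      ∑ i ∈ Finset.range n, (diagram β).rowLen i = n := by
    rw [sum_rowLen_diagram α (by omega), sum_rowLen_diagram β (by omega), hab]
  ext d
  -- Enough variables for the exponent `d` and for the partitions of `n`.
  obtain ⟨N, hN, hd⟩ : ∃ N, n ≤ N ∧ ∀ k, N ≤ k → d k = 0 := by
    refine ⟨max n (d.support.sup id + 1), le_max_left _ _, fun k hk => ?_⟩
    by_contra h
    have h1 : k ≤ d.support.sup id := Finset.le_sup (f := id) (Finsupp.mem_support_iff.2 h)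
    have h2 := (le_max_right _ _).trans hk
    omega
  have key : schurPoly N (diagram α).rowLen * schurPoly N (diagram β).rowLen =
      ∑ p : n.Partition,
        (lrCoeff n (diagram α) (diagram β) p : ℚ) • schurPoly N (diagram p).rowLen := by
    rw [schurPoly_mul_schurPoly (rowLen_antitone _) (rowLen_antitone _)
      fun i hi => hα0 i (by omega)]
    change ∑ g ∈ lrPatterns N _ _, _ = _
    rw [lrPatterns_eq hα0 hβ0 hsum hN]
    simp only [lrCoeff, ← Finset.sum_boole, Finset.sum_smul, ite_smul, one_smul, zero_smul]
    rw [Finset.sum_comm]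
    refine Finset.sum_congr rfl fun g hg => ?_
    rw [mem_lrPatterns] at hg
    rw [addWt_eq hg.1 hα0 hβ0 hN]
    obtain ⟨p, hp⟩ := exists_rowLen_diagram_eq (n := n) (hg.2.antitone_addWt hg.1) (N := n)
      (fun i hi => by simp [addWt, not_lt.2 hi]) (by rw [sum_addWt hg.1, hsum])
    rw [Finset.sum_eq_single p, if_pos hp.symm, hp]
    · intro q _ hq
      rw [if_neg]
      intro hc
      exact hq (diagram_injective (rowLen_injective (hc.symm.trans hp.symm)))
    · simp
  rw [coeff_schur_mul_schur (N := N) _ _ d hd, key, map_sum, map_sum, MvPolynomial.coeff_sum]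
  refine Finset.sum_congr rfl fun p _ => ?_
  rw [map_smul, MvPolynomial.coeff_smul, map_smul, coeff_schur (N := N) _ d hd]

theorem lrCoeff_pos {a b : ℕ} {α : a.Partition} {β : b.Partition} {p : n.Partition}
    (h : IsPattern n (diagram β).rowLen g) (hd : Dominant n (diagram α).rowLen g)
    (hp : ∀ k < n, (diagram α).rowLen k + wt n g k = (diagram p).rowLen k) :
    0 < lrCoeff n (diagram α) (diagram β) p := by
  classical
  refine Finset.card_pos.2 ⟨g, Finset.mem_filter.2 ⟨mem_lrPatterns.2 ⟨h, hd⟩, ?_⟩⟩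
  funext k
  unfold addWt
  split_ifs with hk
  · exact hp k hk
  · exact (rowLen_diagram_eq_zero p (by omega)).symm

/-- A product of two multiplicity-free sums of Schur functions dominates a third one as soon as every
term of the latter occurs in some product of terms. -/
theorem schurGE_of_forall_exists {a b : ℕ} (hab : a + b = n) (S : Finset a.Partition)
    (S' : Finset b.Partition) (U : Finset n.Partition)
    (hU : ∀ p ∈ U, ∃ α ∈ S, ∃ β ∈ S', 0 < lrCoeff n (diagram α) (diagram β) p) :
    SchurGE n ((∑ α ∈ S, schur (diagram α)) * ∑ β ∈ S', schur (diagram β))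
      (∑ p ∈ U, schur (diagram p)) := by
  classical
  refine ⟨fun p => (∑ α ∈ S, ∑ β ∈ S', (lrCoeff n (diagram α) (diagram β) p : ℚ)) -
    (if p ∈ U then 1 else 0), fun p => ?_, ?_⟩
  · rw [sub_nonneg]
    split_ifs with hp
    · obtain ⟨α, hα, β, hβ, hpos⟩ := hU p hp
      have h1 : (1 : ℚ) ≤ lrCoeff n (diagram α) (diagram β) p := by exact_mod_cast hpos
      refine h1.trans ?_
      refine (Finset.single_le_sum (f := fun β => (lrCoeff n (diagram α) (diagram β) p : ℚ))
        (fun _ _ => Nat.cast_nonneg _) hβ).trans ?_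
      exact Finset.single_le_sum
        (f := fun α => ∑ β ∈ S', (lrCoeff n (diagram α) (diagram β) p : ℚ))
        (fun _ _ => Finset.sum_nonneg fun _ _ => Nat.cast_nonneg _) hα
    · exact Finset.sum_nonneg fun _ _ => Finset.sum_nonneg fun _ _ => Nat.cast_nonneg _
  · simp only [sub_smul, Finset.sum_sub_distrib, ite_smul, one_smul, zero_smul,
      Finset.sum_ite_mem, Finset.univ_inter]
    congr 1
    simp only [Finset.sum_smul]
    rw [Finset.sum_comm, Finset.sum_mul]
    refine Finset.sum_congr rfl fun α _ => ?_
    rw [Finset.sum_comm, Finset.mul_sum]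
    exact Finset.sum_congr rfl fun β _ => schur_mul_schur α β hab

end Product

/-! ### A linear criterion for the occurrence of a Schur function in a product -/

/-- `g` is a pattern of shape `β` and content `lam - α` whose rows, read from right to left and from
top to bottom, keep `α` a partition.  Unlike `Dominant`, all these conditions are linear, so that
witnesses can be added. -/
structure IsWitness (N : ℕ) (α β lam : ℕ → ℕ) (g : ℕ → ℕ → ℕ) : Prop where
  isPattern : IsPattern N β g
  row_le : ∀ i k, α (k + 1) + ∑ x ∈ Finset.range (i + 1), g (k + 2) x + ∑ x ∈ Finset.range i, g k x ≤
    α k + ∑ x ∈ Finset.range (i + 1), g (k + 1) x + ∑ x ∈ Finset.range i, g (k + 1) x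
  content : ∀ k, α k + ∑ x ∈ Finset.range N, g (k + 1) x = lam k + ∑ x ∈ Finset.range N, g k x

section Witness

variable {N : ℕ} {α β lam α' β' lam' : ℕ → ℕ} {g g' : ℕ → ℕ → ℕ}

theorem IsWitness.add (h : IsWitness N α β lam g) (h' : IsWitness N α' β' lam' g') :
    IsWitness N (α + α') (β + β') (lam + lam') (g + g') where
  isPattern :=
    { zero := fun i => by simp [h.isPattern.zero, h'.isPattern.zero]
      mono := fun k i => Nat.add_le_add (h.isPattern.mono k i) (h'.isPattern.mono k i)
      inter := fun k i => Nat.add_le_add (h.isPattern.inter k i) (h'.isPattern.inter k i)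
      top := fun k hk i => by
        simp [h.isPattern.top k hk i, h'.isPattern.top k hk i] }
  row_le i k := by
    have h1 := h.row_le i k
    have h2 := h'.row_le i k
    simp only [Pi.add_apply, Finset.sum_add_distrib]
    omega
  content k := by
    have h1 := h.content k
    have h2 := h'.content k
    simp only [Pi.add_apply, Finset.sum_add_distrib]
    omega

/-- The row-wise condition implies the column-wise one.  For a column `j` and a letter `k`, let `r` be
the number of rows of level `k + 1` with a cell in column `j`; the row-wise condition is used at
row `r`, or at row `r - 1` when level `k` has fewer than `j` cells there. -/
theorem IsWitness.dominant (h : IsWitness N α β lam g) : Dominant N α g := by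
  classical
  intro j k hk
  have hp := h.isPattern
  have hex : ∃ r, g (k + 1) r ≤ j := ⟨N, by rw [hp.eq_zero (k := k + 1) (by omega)]; omega⟩
  set r := Nat.find hex with hr
  have hr1 : g (k + 1) r ≤ j := Nat.find_spec hex
  have hr2 : ∀ i < r, j < g (k + 1) i := fun i hi => not_le.1 (Nat.find_min hex hi)
  have hrN : r < N := by
    by_contra hc
    have h1 := hr2 (N - 1) (by omega)
    by_cases hk1 : k + 1 ≤ N - 1
    · rw [hp.eq_zero hk1] at h1
      omega
    · omega
  have hsplit : ∀ l, (∀ i, r < i → g l i ≤ j) →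
      excess N g j l = ∑ i ∈ Finset.range r, (g l i - j) + (g l r - j) := by
    intro l hl
    rw [← Finset.sum_range_succ (fun i => g l i - j)]
    refine (Finset.sum_subset (Finset.range_mono hrN) fun i _ hi => ?_).symm
    have := hl i (by simpa using hi)
    omega
  have hl2 : ∀ i, r < i → g (k + 2) i ≤ j := by
    intro i hi
    obtain ⟨i, rfl⟩ : ∃ i', i = i' + 1 := ⟨i - 1, by omega⟩
    have := hp.inter (k + 1) i
    have := hp.anti (k + 1) (show r ≤ i by omega)
    rw [show k + 1 + 1 = k + 2 from rfl] at *
    omega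
  have hl1 : ∀ i, r < i → g (k + 1) i ≤ j := fun i hi => (hp.mono (k + 1) i).trans (hl2 i hi)
  have hl0 : ∀ i, r < i → g k i ≤ j := fun i hi => (hp.mono k i).trans (hl1 i hi)
  have hsub : ∀ (l s : ℕ), (∀ i < s, j ≤ g l i) →
      ∑ i ∈ Finset.range s, (g l i - j) + s * j = ∑ i ∈ Finset.range s, g l i := by
    intro l s hs
    have : s * j = ∑ i ∈ Finset.range s, j := by simp
    rw [this, ← Finset.sum_add_distrib]
    refine Finset.sum_congr rfl fun i hi => ?_
    have := hs i (Finset.mem_range.1 hi)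
    omega
  have m0 := hp.mono k r
  have m1 := hp.mono (k + 1) r
  rw [show k + 1 + 1 = k + 2 from rfl] at m1
  unfold DomAt
  rw [hsplit _ hl2, hsplit _ hl1, hsplit _ hl0]
  have s2 := hsub (k + 2) r fun i hi => (hr2 i hi).le.trans (hp.mono (k + 1) i)
  have s1 := hsub (k + 1) r fun i hi => (hr2 i hi).le
  by_cases hcase : ∀ i < r, j ≤ g k i
  · have s0 := hsub k r hcase
    have hrow := h.row_le r k
    rw [Finset.sum_range_succ, Finset.sum_range_succ _ r] at hrow
    omega
  · push Not at hcase
    obtain ⟨i0, hi0, hlt⟩ := hcase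
    obtain ⟨t, ht⟩ : ∃ t, r = t + 1 := ⟨r - 1, by omega⟩
    have hgt : g k t < j := (hp.anti k (show i0 ≤ t by omega)).trans_lt hlt
    have s0 := hsub k t fun i hi => by
      have := hp.inter k i
      have := hr2 (i + 1) (by omega)
      omega
    have s1' := hsub (k + 1) t fun i hi => (hr2 i (by omega)).le
    have hrow := h.row_le t k
    have hint := hp.inter (k + 1) t
    have hlast := hr2 t (by omega)
    rw [← ht] at hrow hint
    rw [show k + 1 + 1 = k + 2 from rfl] at hint
    have e0 : ∑ i ∈ Finset.range r, (g k i - j) = ∑ i ∈ Finset.range t, (g k i - j) := by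
      rw [ht, Finset.sum_range_succ, Nat.sub_eq_zero_of_le hgt.le, add_zero]
    have e1 : ∑ i ∈ Finset.range r, (g (k + 1) i - j) =
        ∑ i ∈ Finset.range t, (g (k + 1) i - j) + (g (k + 1) t - j) := by
      rw [ht, Finset.sum_range_succ]
    have hr0 : g k r ≤ j := m0.trans hr1
    omega

end Witness

/-- The partition with a single column, of length `a`. -/
def col (a k : ℕ) : ℕ := if k < a then 1 else 0

theorem col_zero : col 0 = 0 := by
  funext k
  simp [col]

theorem sum_col (N H : ℕ) : ∑ x ∈ Finset.range N, col H x = min N H := by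
  induction N with
  | zero => simp
  | succ N ih =>
    rw [Finset.sum_range_succ, ih, col]
    split_ifs <;> omega

theorem col_antitone (a : ℕ) : Antitone (col a) := by
  refine antitone_nat_of_succ_le fun k => ?_
  unfold col
  split_ifs <;> omega

/-- The two-column instance of the Pieri rule: the product of the Schur functions of columns of
lengths `a` and `b` contains that of the columns `c ≥ d` if `a + b = c + d` and `d ≤ a ≤ c`.
The tableau is a column with entries `0, …, d - 1, a, …, c - 1`. -/
theorem isWitness_col {N a c d : ℕ} (hd : d ≤ a) (ha : a ≤ c) (hc : c ≤ N) :
    IsWitness N (col a) (col (c + d - a)) (col c + col d)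
      (fun k => col (min k d + (min k c - a))) where
  isPattern :=
    { zero := fun i => by simp [col]
      mono := fun k i => by
        unfold col
        split_ifs <;> omega
      inter := fun k i => by
        unfold col
        split_ifs <;> omega
      top := fun k hk i => by
        congr 1
        omega }
  row_le i k := by
    simp only [sum_col]
    unfold col
    split_ifs <;> omega
  content k := by
    simp only [sum_col, Pi.add_apply]
    unfold col
    split_ifs <;> omega

/-! ### Distributing the columns of a partition -/

/-- The Schur function of `lam` occurs in a product of Schur functions of `α` and `β`, where `α` has
size `s`, at least `u` of its columns have length at least `p` and at most `u` are longer than `p`, and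
likewise for `v`, `q` and `β`.  When `u = p` and `v = q` these are the Durfee ranks of `α`
and `β`. -/
def Splits (N p q : ℕ) (lam : ℕ → ℕ) (s u v : ℕ) : Prop :=
  ∃ α β g, Antitone α ∧ (∀ k, N ≤ k → α k = 0) ∧ IsWitness N α β lam g ∧
    ∑ k ∈ Finset.range N, α k = s ∧ (u ≤ α (p - 1) ∧ α p ≤ u) ∧ v ≤ β (q - 1) ∧ β q ≤ v

section Splits

variable {N p q : ℕ}

theorem Splits.add {lam lam' : ℕ → ℕ} {s s' u u' v v' : ℕ} (h : Splits N p q lam s u v)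
    (h' : Splits N p q lam' s' u' v') : Splits N p q (lam + lam') (s + s') (u + u') (v + v') := by
  obtain ⟨α, β, g, h1, h2, h3, h4, h5, h6, h7⟩ := h
  obtain ⟨α', β', g', h1', h2', h3', h4', h5', h6', h7'⟩ := h'
  refine ⟨α + α', β + β', g + g', h1.add h1', fun k hk => ?_, h3.add h3', ?_,
    ⟨Nat.add_le_add h5.1 h5'.1, Nat.add_le_add h5.2 h5'.2⟩, Nat.add_le_add h6 h6',
    Nat.add_le_add h7 h7'⟩
  · simp [h2 k hk, h2' k hk]
  · simp only [Pi.add_apply]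
    rw [Finset.sum_add_distrib, h4, h4']

theorem splits_zero : Splits N p q 0 0 0 0 :=
  ⟨0, 0, 0, fun _ _ _ => le_rfl, fun _ _ => rfl,
    ⟨⟨fun _ => rfl, fun _ _ => le_rfl, fun _ _ => le_rfl, fun _ _ _ => rfl⟩, by simp, by simp⟩,
    by simp, by simp, by simp, by simp⟩

theorem splits_two_col {a c d u v : ℕ} (hd : d ≤ a) (ha : a ≤ c) (hc : c ≤ N)
    (hu : u ≤ col a (p - 1) ∧ col a p ≤ u)
    (hv : v ≤ col (c + d - a) (q - 1) ∧ col (c + d - a) q ≤ v) :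
    Splits N p q (col c + col d) a u v :=
  ⟨col a, _, _, col_antitone a, fun k hk => by unfold col; split_ifs <;> omega,
    isWitness_col hd ha hc, by rw [sum_col]; omega, hu, hv⟩

theorem splits_one_col {a c u v : ℕ} (ha : a ≤ c) (hc : c ≤ N)
    (hu : u ≤ col a (p - 1) ∧ col a p ≤ u)
    (hv : v ≤ col (c - a) (q - 1) ∧ col (c - a) q ≤ v) :
    Splits N p q (col c) a u v := by
  have := splits_two_col (d := 0) (Nat.zero_le a) ha hc hu hv
  rwa [col_zero, add_zero] at this

/-- `Splits` for all sizes `s` in a nonempty interval. -/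
def SplitsIcc (N p q : ℕ) (lam : ℕ → ℕ) (l h u v : ℕ) : Prop :=
  l ≤ h ∧ ∀ s, l ≤ s → s ≤ h → Splits N p q lam s u v

theorem SplitsIcc.add {lam lam' : ℕ → ℕ} {l l' h h' u u' v v' : ℕ}
    (H : SplitsIcc N p q lam l h u v) (H' : SplitsIcc N p q lam' l' h' u' v') :
    SplitsIcc N p q (lam + lam') (l + l') (h + h') (u + u') (v + v') := by
  have := H.1
  have := H'.1
  refine ⟨by omega, fun s h1 h2 => ?_⟩
  have h3 := (H.2 (max l (s - h')) (by omega) (by omega)).add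
    (H'.2 (s - max l (s - h')) (by omega) (by omega))
  rwa [show max l (s - h') + (s - max l (s - h')) = s by omega] at h3

theorem splitsIcc_sum {lam : ℕ → ℕ → ℕ} {l h : ℕ → ℕ} {u v : ℕ} (n : ℕ)
    (H : ∀ j < n, SplitsIcc N p q (lam j) (l j) (h j) u v) :
    SplitsIcc N p q (∑ j ∈ Finset.range n, lam j) (∑ j ∈ Finset.range n, l j)
      (∑ j ∈ Finset.range n, h j) (n * u) (n * v) := by
  induction n with
  | zero =>
    refine ⟨by simp, fun s _ hs => ?_⟩
    simp only [Finset.range_zero, Finset.sum_empty, Nat.le_zero_eq] at hs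
    subst hs
    simpa using splits_zero
  | succ n ih =>
    rw [Finset.sum_range_succ, Finset.sum_range_succ, Finset.sum_range_succ, Nat.succ_mul,
      Nat.succ_mul]
    exact (ih fun j hj => H j (by omega)).add (H n (by omega))

/-- A pair of columns `c ≥ d` is distributed so that `α` and `β` receive one long column each. For
sizes between `d` and `c` the two columns are exchanged for two others; otherwise one of `α`, `β`
receives the whole longer column, and the shorter column is cut. -/
theorem splitsIcc_pair {c d l h : ℕ} (hp : 1 ≤ p) (hq : 1 ≤ q) (hpd : p ≤ d) (hqd : q ≤ d)
    (hdc : d ≤ c) (hcN : c ≤ N) (hl1 : d ≤ l + q) (hl2 : p ≤ l) (hh1 : h ≤ c + p)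
    (hh2 : h + q ≤ c + d) (hlh : l ≤ h) :
    SplitsIcc N p q (col c + col d) l h 1 1 := by
  refine ⟨hlh, fun s h1 h2 => ?_⟩
  rcases le_or_gt s c with hsc | hsc
  · rcases le_or_gt d s with hds | hds
    · refine splits_two_col hds hsc hcN ?_ ?_ <;> unfold col <;> constructor <;>
        split_ifs <;> omega
    · have e1 : Splits N p q (col c) 0 0 1 := by
        refine splits_one_col (Nat.zero_le c) hcN ?_ ?_ <;> unfold col <;> constructor <;>
          split_ifs <;> omega
      have e2 : Splits N p q (col d) s 1 0 := by
        refine splits_one_col hds.le (hdc.trans hcN) ?_ ?_ <;> unfold col <;> constructor <;>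
          split_ifs <;> omega
      simpa using e1.add e2
  · have e1 : Splits N p q (col c) c 1 0 := by
      refine splits_one_col le_rfl hcN ?_ ?_ <;> unfold col <;> constructor <;>
        split_ifs <;> omega
    have e2 : Splits N p q (col d) (s - c) 0 1 := by
      refine splits_one_col (by omega) (hdc.trans hcN) ?_ ?_ <;> unfold col <;> constructor <;>
        split_ifs <;> omega
    have := e1.add e2
    rwa [show c + (s - c) = s by omega] at this

/-- A short column is cut into two pieces which do not influence the Durfee ranks. -/
theorem splitsIcc_short {c : ℕ} (hp : 1 ≤ p) (hq : 1 ≤ q) (hc : c ≤ p + q) (hcN : c ≤ N) :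
    SplitsIcc N p q (col c) (c - q) (min c p) 0 0 := by
  refine ⟨by omega, fun s h1 h2 => splits_one_col (by omega) hcN ?_ ?_⟩ <;> unfold col <;>
    constructor <;> split_ifs <;> omega

/-- A column is cut so that only `β` receives a long piece. -/
theorem splitsIcc_right {c h : ℕ} (hq : 1 ≤ q) (hh : h ≤ p) (hhc : h + q ≤ c)
    (hcN : c ≤ N) : SplitsIcc N p q (col c) 0 h 0 1 := by
  refine ⟨by omega, fun s h1 h2 => splits_one_col (by omega) hcN ?_ ?_⟩ <;> unfold col <;>
    constructor <;> split_ifs <;> omega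

/-- A column is cut into two long pieces. -/
theorem splitsIcc_both {c : ℕ} (hp : 1 ≤ p) (hq : 1 ≤ q) (hc : p + q ≤ c) (hcN : c ≤ N) :
    SplitsIcc N p q (col c) p (c - q) 1 1 := by
  refine ⟨by omega, fun s h1 h2 => splits_one_col (by omega) hcN ?_ ?_⟩ <;> unfold col <;>
    constructor <;> split_ifs <;> omega

end Splits

/-! ### Durfee ranks in terms of rows and columns -/

section Durfee

theorem square_subset_iff {μ : YoungDiagram} {r : ℕ} (hr : 1 ≤ r) :
    Finset.range r ×ˢ Finset.range r ⊆ μ.cells ↔ (r - 1, r - 1) ∈ μ := by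
  constructor
  · intro h
    rw [← YoungDiagram.mem_cells]
    exact h (by simp; omega)
  · rintro h ⟨i, j⟩ hij
    simp only [Finset.mem_product, Finset.mem_range] at hij
    rw [YoungDiagram.mem_cells]
    exact μ.up_left_mem (by omega) (by omega) h

theorem durfeeRank_eq {μ : YoungDiagram} {r : ℕ} (hr : 1 ≤ r) (h1 : r ≤ μ.rowLen (r - 1))
    (h2 : μ.rowLen r ≤ r) : durfeeRank μ = r := by
  refine (isGreatest_durfeeRank μ).unique ⟨?_, fun t ht => ?_⟩
  · refine (square_subset_iff hr).2 (YoungDiagram.mem_iff_lt_rowLen.2 ?_)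
    omega
  · by_contra hc
    have h3 := (square_subset_iff (by omega)).1 ht
    have h4 : (r, r) ∈ μ := μ.up_left_mem (by omega) (by omega) h3
    rw [YoungDiagram.mem_iff_lt_rowLen] at h4
    omega

theorem le_colLen_of_lt_durfeeRank {μ : YoungDiagram} {r j : ℕ} (h : durfeeRank μ = r)
    (hj : j < r) : r ≤ μ.colLen j := by
  have h1 := (isGreatest_durfeeRank μ).1
  rw [h] at h1
  have h2 := (square_subset_iff (by omega)).1 h1
  have h3 : (r - 1, j) ∈ μ := μ.up_left_mem le_rfl (by omega) h2
  rw [YoungDiagram.mem_iff_lt_colLen] at h3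
  omega

theorem colLen_le_of_durfeeRank_le {μ : YoungDiagram} {r j : ℕ} (h : durfeeRank μ = r)
    (hj : r ≤ j) : μ.colLen j ≤ r := by
  by_contra hc
  have h1 : (r, j) ∈ μ := YoungDiagram.mem_iff_lt_colLen.2 (not_le.1 hc)
  have h2 : Finset.range (r + 1) ×ˢ Finset.range (r + 1) ⊆ μ.cells :=
    (square_subset_iff (by omega)).2 (μ.up_left_mem (by omega) hj h1)
  have := (isGreatest_durfeeRank μ).2 h2
  omega

theorem rowLen_eq_sum_col {μ : YoungDiagram} {L : ℕ} (hL : μ.rowLen 0 ≤ L) :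
    μ.rowLen = ∑ j ∈ Finset.range L, col (μ.colLen j) := by
  funext i
  rw [Finset.sum_apply]
  have h1 : ∀ j, col (μ.colLen j) i = col (μ.rowLen i) j := by
    intro j
    have h2 : i < μ.colLen j ↔ j < μ.rowLen i := by
      rw [← YoungDiagram.mem_iff_lt_colLen, ← YoungDiagram.mem_iff_lt_rowLen]
    simp only [col, h2]
  simp only [h1]
  rw [sum_col]
  have := μ.rowLen_anti 0 i (Nat.zero_le i)
  omega

theorem colLen_antitone (μ : YoungDiagram) : Antitone μ.colLen :=
  fun i j hij => μ.colLen_anti i j hij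

theorem sum_colLen_diagram {n : ℕ} (p : n.Partition) {L : ℕ} (hL : (diagram p).rowLen 0 ≤ L) :
    ∑ j ∈ Finset.range L, (diagram p).colLen j = n := by
  conv_rhs => rw [← sum_rowLen_diagram p le_rfl, rowLen_eq_sum_col hL]
  simp only [Finset.sum_apply]
  rw [Finset.sum_comm]
  refine Finset.sum_congr rfl fun j _ => ?_
  rw [sum_col]
  have := (colLen_antitone (diagram p) (Nat.zero_le j)).trans (colLen_diagram_le p)
  omega

/-- A splitting of a partition of `n` yields partitions of the required Durfee ranks with a positive
Littlewood–Richardson coefficient. -/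
theorem Splits.exists_lrCoeff_pos {n k p q : ℕ} {lam : n.Partition} (hp : 1 ≤ p) (hq : 1 ≤ q)
    (h : Splits n p q (diagram lam).rowLen k p q) :
    ∃ (α : k.Partition) (β : (n - k).Partition), durfeeRank (diagram α) = p ∧
      durfeeRank (diagram β) = q ∧ 0 < lrCoeff n (diagram α) (diagram β) lam := by
  obtain ⟨α, β, g, h1, h2, h3, h4, h5, h6⟩ := h
  have hpat := h3.isPattern
  have hβ : Antitone β := fun i j hij => by
    rw [← hpat.top n le_rfl, ← hpat.top n le_rfl]
    exact hpat.anti n hij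
  have hwt : ∀ i < n, α i + wt n g i = (diagram lam).rowLen i := by
    intro i _
    have := h3.content i
    have := hpat.excess_mono 0 i
    unfold wt
    unfold excess at *
    simp only [Nat.sub_zero] at *
    omega
  have hsum : ∑ i ∈ Finset.range n, β i = n - k := by
    have e1 := sum_wt hpat
    have e2 : ∑ i ∈ Finset.range n, α i + ∑ i ∈ Finset.range n, wt n g i = n := by
      rw [← Finset.sum_add_distrib]
      conv_rhs => rw [← sum_rowLen_diagram lam le_rfl]
      exact Finset.sum_congr rfl fun i hi => hwt i (Finset.mem_range.1 hi)
    omega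
  obtain ⟨A, hA⟩ := exists_rowLen_diagram_eq h1 h2 h4
  obtain ⟨B, hB⟩ := exists_rowLen_diagram_eq hβ (fun i hi => hpat.shape_eq_zero hi) hsum
  refine ⟨A, B, durfeeRank_eq hp ?_ ?_, durfeeRank_eq hq ?_ ?_, lrCoeff_pos (g := g) ?_ ?_ ?_⟩
  · rw [hA]; exact h5.1
  · rw [hA]; exact h5.2
  · rw [hB]; exact h6.1
  · rw [hB]; exact h6.2
  · rw [hB]; exact hpat
  · rw [hA]; exact h3.dominant
  · rw [hA]; exact hwt

end Durfee

/-! ### Partitions of even Durfee rank -/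

section Columns

/-- The sum over an initial segment, with the first `2 * m` terms grouped in pairs. -/
theorem sum_range_pairs {M : Type*} [AddCommMonoid M] (f : ℕ → M) (m L : ℕ) :
    ∑ j ∈ Finset.range (2 * m + L), f j =
      ∑ j ∈ Finset.range m, (f j + f (m + j)) + ∑ j ∈ Finset.range L, f (2 * m + j) := by
  rw [Finset.sum_range_add, two_mul, Finset.sum_range_add, Finset.sum_add_distrib]

theorem splits_even {n k m : ℕ} (hm : 1 ≤ m) {lam : n.Partition}
    (hd : durfeeRank (diagram lam) = 2 * m) (hk1 : (n - 1) / 2 ≤ k)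
    (hk2 : k ≤ (n - 1) / 2 + m ^ 2) : Splits n m m (diagram lam).rowLen k m m := by
  set c := (diagram lam).colLen with hc
  set L := (diagram lam).rowLen 0 with hL
  have hanti : Antitone c := colLen_antitone _
  have hcn : ∀ j, c j ≤ n := fun j => (hanti (Nat.zero_le j)).trans (colLen_diagram_le lam)
  have hbig : ∀ j < 2 * m, 2 * m ≤ c j := fun j hj => le_colLen_of_lt_durfeeRank hd hj
  have hsmall : ∀ j, 2 * m ≤ j → c j ≤ 2 * m := fun j hj => colLen_le_of_durfeeRank_le hd hj
  have hLL : (diagram lam).rowLen 0 ≤ 2 * m + L := by omega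
  have hpairs := splitsIcc_sum (N := n) (p := m) (q := m)
    (lam := fun j => col (c j) + col (c (m + j))) (l := fun j => c (m + j) - m)
    (h := fun j => c j + m) (u := 1) (v := 1) m fun j hj => by
      have h1 := hbig (m + j) (by omega)
      have h2 := hanti (show j ≤ m + j by omega)
      exact splitsIcc_pair hm hm (by omega) (by omega) h2 (hcn j) (by omega) (by omega)
        (by omega) (by omega) (by omega)
  have hshort := splitsIcc_sum (N := n) (p := m) (q := m)
    (lam := fun j => col (c (2 * m + j))) (l := fun j => c (2 * m + j) - m)
    (h := fun j => min (c (2 * m + j)) m) (u := 0) (v := 0) L fun j _ => by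
      have h1 := hsmall (2 * m + j) (by omega)
      exact splitsIcc_short hm hm (by omega) (hcn _)
  have H := hpairs.add hshort
  rw [← sum_range_pairs (fun j => col (c j)), hc, ← rowLen_eq_sum_col hLL, ← hc] at H
  simp only [mul_one, mul_zero, add_zero] at H
  refine H.2 k ?_ ?_
  all_goals
    have hn := sum_colLen_diagram lam hLL
    rw [← hc, sum_range_pairs, Finset.sum_add_distrib] at hn
    have hAB : ∑ j ∈ Finset.range m, c (m + j) ≤ ∑ j ∈ Finset.range m, c j :=
      Finset.sum_le_sum fun j _ => hanti (by omega)
    have hl : ∑ j ∈ Finset.range m, (c (m + j) - m) + m * m = ∑ j ∈ Finset.range m, c (m + j) := by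
      have : m * m = ∑ j ∈ Finset.range m, m := by simp
      rw [this, ← Finset.sum_add_distrib]
      refine Finset.sum_congr rfl fun j hj => ?_
      have := hbig (m + j) (by have := Finset.mem_range.1 hj; omega)
      omega
    have hh : ∑ j ∈ Finset.range m, (c j + m) = ∑ j ∈ Finset.range m, c j + m * m := by
      simp [Finset.sum_add_distrib]
    have hVW : ∑ j ∈ Finset.range L, (c (2 * m + j) - m) +
        ∑ j ∈ Finset.range L, min (c (2 * m + j)) m = ∑ j ∈ Finset.range L, c (2 * m + j) := by
      rw [← Finset.sum_add_distrib]
      exact Finset.sum_congr rfl fun j _ => by omega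
    have hWV : ∑ j ∈ Finset.range L, (c (2 * m + j) - m) ≤
        ∑ j ∈ Finset.range L, min (c (2 * m + j)) m := by
      refine Finset.sum_le_sum fun j _ => ?_
      have := hsmall (2 * m + j) (by omega)
      omega
    have hmm : 1 ≤ m * m := Nat.mul_pos hm hm
    rw [pow_two] at hk2
    omega

/-! ### Partitions of odd Durfee rank -/

/-- The column lengths of a partition of `n` of Durfee rank `2 * M + 1`, of which all but the
first `2 * M + 2 + L` vanish. -/
structure OddColumns (n M L : ℕ) (c : ℕ → ℕ) : Prop where
  anti : Antitone c
  le : ∀ j, c j ≤ n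
  big : ∀ j, j < 2 * M + 1 → 2 * M + 1 ≤ c j
  small : ∀ j, 2 * M + 1 ≤ j → c j ≤ 2 * M + 1
  sum : ∑ j ∈ Finset.range (2 * M + 2 + L), c j = n

/-- The grouping of columns used for odd Durfee rank `2 * M + 1`: the pairs `(j, M + 1 + j)`, the
middle column `M` of the square, the first column to the right of the square, and the others. -/
theorem sum_range_odd {A : Type*} [AddCommMonoid A] (f : ℕ → A) (M L : ℕ) :
    ∑ j ∈ Finset.range (2 * M + 2 + L), f j =
      ∑ j ∈ Finset.range M, (f j + f (M + 1 + j)) +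
        (f M + (f (2 * M + 1) + ∑ j ∈ Finset.range L, f (2 * M + 2 + j))) := by
  have h : ∑ j ∈ Finset.range (2 * M + 1), f j =
      ∑ j ∈ Finset.range M, (f j + f (M + 1 + j)) + f M := by
    rw [show 2 * M + 1 = (M + 1) + M by ring, Finset.sum_range_add, Finset.sum_range_succ,
      Finset.sum_add_distrib]
    abel
  rw [Finset.sum_range_add, show 2 * M + 2 = 2 * M + 1 + 1 from rfl, Finset.sum_range_succ, h]
  abel

namespace OddColumns

variable {n M L k : ℕ} {c : ℕ → ℕ}

theorem sum_eq (H : OddColumns n M L c) :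
    ∑ j ∈ Finset.range M, c j + ∑ j ∈ Finset.range M, c (M + 1 + j) +
      (c M + (c (2 * M + 1) + ∑ j ∈ Finset.range L, c (2 * M + 2 + j))) = n := by
  rw [← H.sum, sum_range_odd, Finset.sum_add_distrib]

theorem sum_sub_const (H : OddColumns n M L c) :
    ∑ j ∈ Finset.range M, (c (M + 1 + j) - M) + M * M = ∑ j ∈ Finset.range M, c (M + 1 + j) := by
  have : M * M = ∑ j ∈ Finset.range M, M := by simp
  rw [this, ← Finset.sum_add_distrib]
  refine Finset.sum_congr rfl fun j hj => ?_
  have := H.big (M + 1 + j) (by have := Finset.mem_range.1 hj; omega)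
  omega

theorem sum_tails (m : ℕ) :
    ∑ j ∈ Finset.range L, (c (2 * M + 2 + j) - m) + ∑ j ∈ Finset.range L, min (c (2 * M + 2 + j)) m =
      ∑ j ∈ Finset.range L, c (2 * M + 2 + j) := by
  rw [← Finset.sum_add_distrib]
  exact Finset.sum_congr rfl fun j _ => by omega

theorem sum_tails_le (H : OddColumns n M L c) :
    ∑ j ∈ Finset.range L, (c (2 * M + 2 + j) - (M + 1)) ≤
      ∑ j ∈ Finset.range L, min (c (2 * M + 2 + j)) (M + 1) := by
  refine Finset.sum_le_sum fun j _ => ?_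
  have := H.small (2 * M + 2 + j) (by omega)
  omega

theorem sum_tails_eq_zero (H : OddColumns n M L c) {m : ℕ} (h : c (2 * M + 2) ≤ m) :
    ∑ j ∈ Finset.range L, (c (2 * M + 2 + j) - m) = 0 := by
  refine Finset.sum_eq_zero fun j _ => ?_
  have := H.anti (show 2 * M + 2 ≤ 2 * M + 2 + j by omega)
  omega

/-- The number of columns longer than `2 * M + 1` among the last `M` columns of the square.  If column
`M` is also longer, then `M + 1 + extra M c` is the length of the first row below the square. -/
def extra (M : ℕ) (c : ℕ → ℕ) : ℕ :=
  ∑ j ∈ Finset.range M, min 1 (c (M + 1 + j) - (2 * M + 1))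

theorem extra_le : extra M c ≤ M := by
  calc extra M c ≤ ∑ j ∈ Finset.range M, 1 := Finset.sum_le_sum fun j _ => by omega
    _ = M := by simp

theorem sum_right_eq (H : OddColumns n M L c) (h : c (M + 1) ≤ 2 * M + 2) :
    ∑ j ∈ Finset.range M, c (M + 1 + j) = 2 * (M * M) + M + extra M c := by
  have : 2 * (M * M) + M = ∑ j ∈ Finset.range M, (2 * M + 1) := by
    simp; ring
  rw [this, extra, ← Finset.sum_add_distrib]
  refine Finset.sum_congr rfl fun j hj => ?_
  have h1 := H.big (M + 1 + j) (by have := Finset.mem_range.1 hj; omega)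
  have h2 := H.anti (show M + 1 ≤ M + 1 + j by omega)
  omega

theorem extra_eq_zero (H : OddColumns n M L c) (h : c (M + 1) ≤ 2 * M + 1) : extra M c = 0 := by
  refine Finset.sum_eq_zero fun j _ => ?_
  have h2 := H.anti (show M + 1 ≤ M + 1 + j by omega)
  omega

/-- A column `j < M` is at least as long as its partner `M + 1 + j`, and longer by at least `a` if the
partner ends at the lower edge of the square; `extra` counts the other pairs. -/
theorem add_le_sum_left (H : OddColumns n M L c) {a : ℕ} (h : 2 * M + 1 + a ≤ c M) :
    ∑ j ∈ Finset.range M, c (M + 1 + j) + a * M ≤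
      ∑ j ∈ Finset.range M, c j + a * extra M c := by
  have : a * M = ∑ j ∈ Finset.range M, a := by simp [mul_comm]
  rw [this, extra, Finset.mul_sum, ← Finset.sum_add_distrib, ← Finset.sum_add_distrib]
  refine Finset.sum_le_sum fun j hj => ?_
  have hj := Finset.mem_range.1 hj
  have h1 := H.anti (show j ≤ M by omega)
  have h2 := H.anti (show j ≤ M + 1 + j by omega)
  have h3 := H.big (M + 1 + j) (by omega)
  rcases Nat.eq_or_lt_of_le h3 with h4 | h4
  · omega
  · rw [show min 1 (c (M + 1 + j) - (2 * M + 1)) = 1 by omega]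
    omega

/-- No row below the square and no column to its right is longer than `M`.  Then `α` gets
Durfee rank `M` and may receive everything below and to the right of the square. -/
theorem splits_of_short (H : OddColumns n M L c) (hM : 1 ≤ M) (ht : c (2 * M + 1) ≤ M)
    (hmid : c M ≤ 2 * M + 1) (hk1 : (n - 1) / 2 ≤ k) (hk2 : k + (M + 1) ^ 2 ≤ n) :
    Splits n M (M + 1) (∑ j ∈ Finset.range (2 * M + 2 + L), col (c j)) k M (M + 1) := by
  have hpairs := splitsIcc_sum (N := n) (p := M) (q := M + 1)
    (lam := fun j => col (c j) + col (c (M + 1 + j))) (l := fun j => c (M + 1 + j) - (M + 1))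
    (h := fun j => c j + M) (u := 1) (v := 1) M fun j hj => by
      have h1 := H.big (M + 1 + j) (by omega)
      have h2 := H.anti (show j ≤ M + 1 + j by omega)
      exact splitsIcc_pair hM (by omega) (by omega) (by omega) h2 (H.le j) (by omega) (by omega)
        (by omega) (by omega) (by omega)
  have hmidS := splitsIcc_right (N := n) (p := M) (q := M + 1) (c := c M) (h := M) (by omega) le_rfl
    (by have := H.big M (by omega); omega) (H.le M)
  have htS := splitsIcc_short (N := n) (p := M) (q := M + 1) (c := c (2 * M + 1)) hM (by omega)
    (by omega) (H.le _)
  have hshort := splitsIcc_sum (N := n) (p := M) (q := M + 1)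
    (lam := fun j => col (c (2 * M + 2 + j))) (l := fun j => c (2 * M + 2 + j) - (M + 1))
    (h := fun j => min (c (2 * M + 2 + j)) M) (u := 0) (v := 0) L fun j _ => by
      have h1 := H.small (2 * M + 2 + j) (by omega)
      exact splitsIcc_short hM (by omega) (by omega) (H.le _)
  have HS := hpairs.add (hmidS.add (htS.add hshort))
  rw [← sum_range_odd (fun j => col (c j))] at HS
  simp only [mul_one, mul_zero, add_zero, zero_add] at HS
  have hn := H.sum_eq
  have h0 := H.anti (show 2 * M + 1 ≤ 2 * M + 2 by omega)
  have hW : ∑ j ∈ Finset.range L, (c (2 * M + 2 + j) - M) = 0 := H.sum_tails_eq_zero (by omega)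
  have hW' : ∑ j ∈ Finset.range L, (c (2 * M + 2 + j) - (M + 1)) = 0 :=
    H.sum_tails_eq_zero (by omega)
  have hV := sum_tails (c := c) (M := M) (L := L) M
  have h1 := H.anti (show M ≤ M + 1 by omega)
  have h2 := H.sum_right_eq (by omega)
  rw [H.extra_eq_zero (by omega)] at h2
  have h3 : ∑ j ∈ Finset.range M, (c (M + 1 + j) - (M + 1)) ≤
      ∑ j ∈ Finset.range M, (c (M + 1 + j) - M) := Finset.sum_le_sum fun j _ => by omega
  have h4 := H.sum_sub_const
  have h5 : ∑ j ∈ Finset.range M, (c j + M) = ∑ j ∈ Finset.range M, c j + M * M := by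
    simp [Finset.sum_add_distrib]
  have h6 := H.add_le_sum_left (a := 0) (by have := H.big M (by omega); omega)
  have h7 := H.big M (by omega)
  have h8 : (M + 1) ^ 2 = M * M + 2 * M + 1 := by ring
  rw [h8] at hk2
  exact HS.2 k (by omega) (by omega)

/-- A column of length at least `M + 1` to the right of the square, not shorter than the longest
row below the square: it is paired with the middle column and gives `β` its long column. -/
theorem splits_of_long_column (H : OddColumns n M L c) (hM : 1 ≤ M) (hL : 1 ≤ L)
    (ht : M + 1 ≤ c (2 * M + 1))
    (hcase : c M ≤ 2 * M + 1 ∨ M + 1 + extra M c ≤ c (2 * M + 1)) (hk1 : (n - 1) / 2 ≤ k)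
    (hk2 : k + (M + 1) ^ 2 ≤ n) (hk3 : k ≤ (n - 1) / 2 + (M + 1) ^ 2 - M) :
    Splits n (M + 1) (M + 1) (∑ j ∈ Finset.range (2 * M + 2 + L), col (c j)) k (M + 1) (M + 1) := by
  have hp : 1 ≤ M + 1 := by omega
  have hpairs := splitsIcc_sum (N := n) (p := M + 1) (q := M + 1)
    (lam := fun j => col (c j) + col (c (M + 1 + j))) (l := fun j => c (M + 1 + j) - M)
    (h := fun j => c j + M) (u := 1) (v := 1) M fun j hj => by
      have h1 := H.big (M + 1 + j) (by omega)
      have h2 := H.anti (show j ≤ M + 1 + j by omega)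
      exact splitsIcc_pair hp hp (by omega) (by omega) h2 (H.le j) (by omega) (by omega)
        (by omega) (by omega) (by omega)
  have hbigM := H.big M (by omega)
  have hsmallt := H.small (2 * M + 1) le_rfl
  have hmidS := splitsIcc_pair (N := n) (p := M + 1) (q := M + 1) (c := c M) (d := c (2 * M + 1))
    (l := M + 1) (h := c M + c (2 * M + 1) - (M + 1)) hp hp ht ht (by omega) (H.le M) (by omega)
    le_rfl (by omega) (by omega) (by omega)
  have hshort := splitsIcc_sum (N := n) (p := M + 1) (q := M + 1)
    (lam := fun j => col (c (2 * M + 2 + j))) (l := fun j => c (2 * M + 2 + j) - (M + 1))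
    (h := fun j => min (c (2 * M + 2 + j)) (M + 1)) (u := 0) (v := 0) L fun j _ => by
      have h1 := H.small (2 * M + 2 + j) (by omega)
      exact splitsIcc_short hp hp (by omega) (H.le _)
  have HS := hpairs.add (hmidS.add hshort)
  rw [add_assoc (col (c M)), ← sum_range_odd (fun j => col (c j))] at HS
  simp only [mul_one, mul_zero, add_zero] at HS
  have hn := H.sum_eq
  have hV := sum_tails (c := c) (M := M) (L := L) (M + 1)
  have hWV := H.sum_tails_le
  have h4 := H.sum_sub_const
  have h5 : ∑ j ∈ Finset.range M, (c j + M) = ∑ j ∈ Finset.range M, c j + M * M := by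
    simp [Finset.sum_add_distrib]
  have h6 := H.add_le_sum_left (a := 0) hbigM
  have h8 : (M + 1) ^ 2 = M * M + 2 * M + 1 := by ring
  have h9 : M ≤ M * M := Nat.le_mul_self M
  rw [h8] at hk2 hk3
  refine HS.2 k (by omega) ?_
  -- If a second row or column is longer than `M + 1`, the bound needed is the one by half of `n`;
  -- otherwise it is the one by `n - (M + 1) ^ 2`.
  rcases le_or_gt (2 * M + 2) (c (M + 1)) with hx | hx
  · have h10 := H.anti (show M ≤ M + 1 by omega)
    have h11 := H.add_le_sum_left (a := 1) (by omega)
    omega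
  · rcases le_or_gt (c (2 * M + 2)) (M + 1) with hy | hy
    · have h10 := H.sum_right_eq (by omega)
      rw [H.extra_eq_zero (by omega)] at h10
      have h11 := H.sum_tails_eq_zero hy
      omega
    · obtain ⟨L, rfl⟩ : ∃ L', L = L' + 1 := ⟨L - 1, by omega⟩
      have h10 := H.anti (show 2 * M + 1 ≤ 2 * M + 2 by omega)
      have h11 : ∑ j ∈ Finset.range L, (c (2 * M + 2 + (j + 1)) - (M + 1)) ≤
          ∑ j ∈ Finset.range L, min (c (2 * M + 2 + (j + 1))) (M + 1) := by
        refine Finset.sum_le_sum fun j _ => ?_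
        have := H.small (2 * M + 2 + (j + 1)) (by omega)
        omega
      rw [Finset.sum_range_succ' (fun j => c (2 * M + 2 + j) - (M + 1)),
        Finset.sum_range_succ' (fun j => min (c (2 * M + 2 + j)) (M + 1))] at *
      simp only [add_zero] at *
      omega

/-- A row of length at least `M + 1` below the square, not shorter than the longest column to the
right of the square: the middle column is long enough to give a long column to both `α` and
`β`. -/
theorem splits_of_long_row (H : OddColumns n M L c) (hM : 1 ≤ M) (hmid : 2 * M + 2 ≤ c M)
    (hcase : c (2 * M + 1) ≤ M + 1 + extra M c) (hk1 : (n - 1) / 2 ≤ k)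
    (hk2 : k + (M + 1) ^ 2 ≤ n) (hk3 : k ≤ (n - 1) / 2 + (M + 1) ^ 2 - M) :
    Splits n (M + 1) (M + 1) (∑ j ∈ Finset.range (2 * M + 2 + L), col (c j)) k (M + 1) (M + 1) := by
  have hp : 1 ≤ M + 1 := by omega
  have hpairs := splitsIcc_sum (N := n) (p := M + 1) (q := M + 1)
    (lam := fun j => col (c j) + col (c (M + 1 + j))) (l := fun j => c (M + 1 + j) - M)
    (h := fun j => c j + M + min 1 (c (M + 1 + j) - (2 * M + 1))) (u := 1) (v := 1) M
    fun j hj => by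
      have h1 := H.big (M + 1 + j) (by omega)
      have h2 := H.anti (show j ≤ M + 1 + j by omega)
      exact splitsIcc_pair hp hp (by omega) (by omega) h2 (H.le j) (by omega) (by omega)
        (by omega) (by omega) (by omega)
  have hsmallt := H.small (2 * M + 1) le_rfl
  have hmidS := splitsIcc_both (N := n) (p := M + 1) (q := M + 1) (c := c M) hp hp (by omega) (H.le M)
  have htS := splitsIcc_short (N := n) (p := M + 1) (q := M + 1) (c := c (2 * M + 1)) hp hp
    (by omega) (H.le _)
  have hshort := splitsIcc_sum (N := n) (p := M + 1) (q := M + 1)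
    (lam := fun j => col (c (2 * M + 2 + j))) (l := fun j => c (2 * M + 2 + j) - (M + 1))
    (h := fun j => min (c (2 * M + 2 + j)) (M + 1)) (u := 0) (v := 0) L fun j _ => by
      have h1 := H.small (2 * M + 2 + j) (by omega)
      exact splitsIcc_short hp hp (by omega) (H.le _)
  have HS := hpairs.add (hmidS.add (htS.add hshort))
  rw [← sum_range_odd (fun j => col (c j))] at HS
  simp only [mul_one, mul_zero, add_zero] at HS
  have hn := H.sum_eq
  have hV := sum_tails (c := c) (M := M) (L := L) (M + 1)
  have hWV := H.sum_tails_le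
  have h4 := H.sum_sub_const
  have h5 : ∑ j ∈ Finset.range M, (c j + M + min 1 (c (M + 1 + j) - (2 * M + 1))) =
      ∑ j ∈ Finset.range M, c j + M * M + extra M c := by
    simp [Finset.sum_add_distrib, extra]
  have h6 := H.add_le_sum_left (a := 1) (by omega)
  have h8 : (M + 1) ^ 2 = M * M + 2 * M + 1 := by ring
  have h9 : M ≤ M * M := Nat.le_mul_self M
  have h10 := extra_le (M := M) (c := c)
  rw [h8] at hk2 hk3
  refine HS.2 k (by omega) ?_
  -- If a second row or a column is longer than `M + 1`, the bound needed is the one by half of `n`;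
  -- otherwise it is the one by `n - (M + 1) ^ 2`.
  rcases le_or_gt (c (2 * M + 1)) (M + 1) with ht | ht
  · rcases le_or_gt (c (M + 1)) (2 * M + 2) with hx | hx
    · have h11 := H.sum_right_eq hx
      have h12 := H.sum_tails_eq_zero (m := M + 1)
        ((H.anti (show 2 * M + 1 ≤ 2 * M + 2 by omega)).trans ht)
      omega
    · have h11 := H.anti (show M ≤ M + 1 by omega)
      have h12 := H.add_le_sum_left (a := 2) (by omega)
      omega
  · omega

end OddColumns

theorem oddColumns_colLen {n M : ℕ} {lam : n.Partition}
    (hd : durfeeRank (diagram lam) = 2 * M + 1) :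
    OddColumns n M ((diagram lam).rowLen 0 + 1) (diagram lam).colLen where
  anti := colLen_antitone _
  le j := (colLen_antitone _ (Nat.zero_le j)).trans (colLen_diagram_le lam)
  big j hj := le_colLen_of_lt_durfeeRank hd hj
  small j hj := colLen_le_of_durfeeRank_le hd hj
  sum := sum_colLen_diagram lam (by omega)

theorem splits_odd {n k M : ℕ} (hM : 1 ≤ M) {lam : n.Partition}
    (hd : durfeeRank (diagram lam) = 2 * M + 1) (hk1 : (n - 1) / 2 ≤ k)
    (hk2 : k + (M + 1) ^ 2 ≤ n) (hk3 : k ≤ (n - 1) / 2 + (M + 1) ^ 2 - M) :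
    ∃ p, M ≤ p ∧ p ≤ M + 1 ∧ Splits n p (M + 1) (diagram lam).rowLen k p (M + 1) := by
  have H := oddColumns_colLen hd
  rw [rowLen_eq_sum_col (show (diagram lam).rowLen 0 ≤ 2 * M + 2 + ((diagram lam).rowLen 0 + 1) by
    omega)]
  rcases le_or_gt ((diagram lam).colLen M) (2 * M + 1) with hmid | hmid
  · rcases le_or_gt ((diagram lam).colLen (2 * M + 1)) M with ht | ht
    · exact ⟨M, le_rfl, by omega, H.splits_of_short hM ht hmid hk1 hk2⟩
    · exact ⟨M + 1, by omega, le_rfl,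
        H.splits_of_long_column hM (by omega) ht (Or.inl hmid) hk1 hk2 hk3⟩
  · rcases le_or_gt ((diagram lam).colLen (2 * M + 1))
      (M + 1 + OddColumns.extra M (diagram lam).colLen) with ht | ht
    · exact ⟨M + 1, by omega, le_rfl, H.splits_of_long_row hM hmid ht hk1 hk2 hk3⟩
    · exact ⟨M + 1, by omega, le_rfl,
        H.splits_of_long_column hM (by omega) (by omega) (Or.inr ht.le) hk1 hk2 hk3⟩

end Columns

theorem durfeeRank_diagram_zero (p : (0 : ℕ).Partition) : durfeeRank (diagram p) = 0 := by
  by_contra h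
  have h1 := le_colLen_of_lt_durfeeRank (μ := diagram p) rfl (Nat.pos_of_ne_zero h)
  have h2 := colLen_diagram_le p
  omega

theorem schurGE_even {m n k : ℕ} (hm : 1 ≤ m) (h1 : (n - 1) / 2 ≤ k)
    (h2 : k ≤ (n - 1) / 2 + m ^ 2) :
    SchurGE n
      ((∑ α : k.Partition with durfeeRank (diagram α) = m, schur (diagram α)) *
        (∑ β : (n - k).Partition with durfeeRank (diagram β) = m, schur (diagram β)))
      (∑ lam : n.Partition with durfeeRank (diagram lam) = 2 * m, schur (diagram lam)) := by
  rcases le_or_gt k n with hkn | hkn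
  · refine schurGE_of_forall_exists (by omega) _ _ _ fun lam hlam => ?_
    have hd := (Finset.mem_filter.1 hlam).2
    obtain ⟨α, β, hα, hβ, hpos⟩ := (splits_even hm hd h1 h2).exists_lrCoeff_pos hm hm
    exact ⟨α, by simpa using hα, β, by simpa using hβ, hpos⟩
  · -- Here `n - k` truncates to `0`, and both sides are empty sums.
    have e1 : ∀ β : (n - k).Partition, durfeeRank (diagram β) ≠ m := by
      rw [show n - k = 0 by omega]
      intro β hβ
      rw [durfeeRank_diagram_zero] at hβ
      omega
    have e2 : ∀ lam : n.Partition, durfeeRank (diagram lam) ≠ 2 * m := by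
      intro lam hlam
      obtain ⟨α, β, -, hβ, -⟩ := (splits_even hm hlam h1 h2).exists_lrCoeff_pos hm hm
      exact e1 β hβ
    refine ⟨0, fun _ => le_rfl, ?_⟩
    rw [Finset.filter_false_of_mem (s := (Finset.univ : Finset (n - k).Partition))
      fun β _ => e1 β, Finset.filter_false_of_mem (s := (Finset.univ : Finset n.Partition))
      fun lam _ => e2 lam]
    simp

theorem schurGE_odd {m n k : ℕ} (hm : 2 ≤ m) (h1 : (n - 1) / 2 ≤ k)
    (h2 : k ≤ (n - 1) / 2 + m ^ 2 - (m - 1)) (h3 : k + m ^ 2 ≤ n) :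
    SchurGE n
      ((∑ α : k.Partition with
          m - 1 ≤ durfeeRank (diagram α) ∧ durfeeRank (diagram α) ≤ m, schur (diagram α)) *
        (∑ β : (n - k).Partition with durfeeRank (diagram β) = m, schur (diagram β)))
      (∑ lam : n.Partition with durfeeRank (diagram lam) = 2 * m - 1, schur (diagram lam)) := by
  obtain ⟨M, rfl⟩ : ∃ M, m = M + 1 := ⟨m - 1, by omega⟩
  refine schurGE_of_forall_exists (by omega) _ _ _ fun lam hlam => ?_
  have hd := (Finset.mem_filter.1 hlam).2
  obtain ⟨p, hp1, hp2, hs⟩ := splits_odd (M := M) (by omega) (hd.trans (by omega)) h1 h3 h2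
  obtain ⟨α, β, hα, hβ, hpos⟩ := hs.exists_lrCoeff_pos (by omega) (by omega)
  exact ⟨α, by simp [hα]; omega, β, by simpa using hβ, hpos⟩

end DurfeeSchur

theorem mainTheorem9 (m n k : ℕ) (hm : 2 ≤ m) :
    ((n - 1) / 2 ≤ k → k ≤ (n - 1) / 2 + m ^ 2 →
      DurfeeSchur.SchurGE n
        ((∑ α : k.Partition with DurfeeSchur.durfeeRank (DurfeeSchur.diagram α) = m,
            DurfeeSchur.schur (DurfeeSchur.diagram α)) *
          (∑ β : (n - k).Partition with DurfeeSchur.durfeeRank (DurfeeSchur.diagram β) = m,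
            DurfeeSchur.schur (DurfeeSchur.diagram β)))
        (∑ lam : n.Partition with DurfeeSchur.durfeeRank (DurfeeSchur.diagram lam) = 2 * m,
          DurfeeSchur.schur (DurfeeSchur.diagram lam))) ∧
    ((n - 1) / 2 ≤ k → k ≤ (n - 1) / 2 + m ^ 2 - (m - 1) → k + m ^ 2 ≤ n →
      DurfeeSchur.SchurGE n
        ((∑ α : k.Partition with
              m - 1 ≤ DurfeeSchur.durfeeRank (DurfeeSchur.diagram α) ∧
                DurfeeSchur.durfeeRank (DurfeeSchur.diagram α) ≤ m,
            DurfeeSchur.schur (DurfeeSchur.diagram α)) *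
          (∑ β : (n - k).Partition with DurfeeSchur.durfeeRank (DurfeeSchur.diagram β) = m,
            DurfeeSchur.schur (DurfeeSchur.diagram β)))
        (∑ lam : n.Partition with DurfeeSchur.durfeeRank (DurfeeSchur.diagram lam) = 2 * m - 1,
          DurfeeSchur.schur (DurfeeSchur.diagram lam))) :=
  ⟨DurfeeSchur.schurGE_even (by omega), DurfeeSchur.schurGE_odd hm⟩
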